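/- Work with two qubits, $\mathbb C^2\otimes\mathbb C^2$, with product basis $|ij\rangle$. A density matrix is a positive semidefinite matrix of trace one; it is *entangled* if it is not a finite convex combination of products $\sigma\otimes\tau$ of density matrices. The *support* of $\rho$ is its range. For $2\times2$ complex matrices $A,B$ with $\operatorname{Tr}\big((A\otimes B)\rho(A\otimes B)^\dagger\big)\neq0$, the *local operation* (local filtration) given by $A\otimes B$ is $$\Theta(\rho)=\frac{(A\otimes B)\,\rho\,(A\otimes B)^\dagger}{\operatorname{Tr}\big((A\otimes B)\,\rho\,(A\otimes B)^\dagger\big)} .$$ Let $E_F$ be the entanglement of formation, i.e. $E_F(\rho)=\inf\sum_k p_kE(\psi_k)$ over all finite decompositions $\rho=\sum_kp_k|\psi_k\rangle\langle\psi_k|$ into pure states, where $E(\psi)$ is the von Neumann entropy (to base $2$) of the reduced state of $\psi$ on one qubit, and let $M_\rho=\sup_\Theta E_F(\Theta(\rho))$, the supremum being over all local operations. A state is *Bell-diagonal* if, up to a local unitary $U\otimes V$, it is a convex combination of the projectors on the Bell vectors $(|00\rangle\pm|11\rangle)/\sqrt2$, $(|01\rangle\pm|10\rangle)/\sqrt2$.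 The state $\rho$ is *incompletely distillable* if there is a local operation $\Xi$ with $E_F(\Xi(\rho))=M_\rho$ and $\Xi(\rho)$ Bell-diagonal. **Theorem.** Let $\rho$ be an entangled density matrix on $\mathbb C^2\otimes\mathbb C^2$ of rank two. Then $\rho$ is incompletely distillable if and only if its support is spanned by two product vectors $\phi_1\otimes\phi_2$ and $\psi_1\otimes\psi_2$. Moreover, whenever $\phi_1\otimes\phi_2$ and $\psi_1\otimes\psi_2$ span the support of $\rho$, the matrices $S=(\phi_1\,|\,\psi_1)$ and $T=(\psi_2\,|\,\phi_2)$ with the indicated columns are invertible, and $$(S^{-1}\otimes T^{-1})\rho(S^{-1}\otimes T^{-1})^\dagger=a|01\rangle\langle01|+b|01\rangle\langle10|+\bar b|10\rangle\langle01|+d|10\rangle\langle10|$$ with $a,d>0$ and $0<|b|<\sqrt{ad}$. The operation given by $$A\otimes B=\frac1{\sqrt2}\begin{pmatrix}1&0\\0&\frac1{\sqrt d}\end{pmatrix}S^{-1}\otimes\begin{pmatrix}1&0\\0&\frac1{\sqrt a}\end{pmatrix}T^{-1}$$ satisfies $\operatorname{Tr}\big((A\otimes B)\rho(A\otimes B)^\dagger\big)=1$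 and maps $\rho$ directly to the Bell-diagonal state of rank two $$\sigma=\tfrac12|01\rangle\langle01|+f|01\rangle\langle10|+\bar f|10\rangle\langle01|+\tfrac12|10\rangle\langle10|,\qquad f=\frac{b}{2\sqrt{ad}},$$ which is optimal: $E_F(\sigma)=M_\rho<1$. -/

import Mathlib

open scoped Kronecker Matrix ComplexOrder

noncomputable section

/-- State vectors of one qubit, and vectors and operators of two qubits (`ℂ² ⊗ ℂ²`) in coordinates;
the basis vector `|ij⟩` has index `(i, j)`. -/
abbrev QubitVec := Fin 2 → ℂ

abbrev QubitMat := Matrix (Fin 2) (Fin 2) ℂ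

abbrev PairVec := Fin 2 × Fin 2 → ℂ

abbrev PairMat := Matrix (Fin 2 × Fin 2) (Fin 2 × Fin 2) ℂ

/-- The product (factorising) vector `φ₁ ⊗ φ₂`. -/
def prodVec (φ₁ φ₂ : QubitVec) : PairVec := fun i => φ₁ i.1 * φ₂ i.2

/-- The rank-one operator `|ψ⟩⟨ψ|`. -/
def ketBra {n : Type*} (ψ : n → ℂ) : Matrix n n ℂ := Matrix.vecMulVec ψ (star ψ)

def IsUnitVec {n : Type*} [Fintype n] (ψ : n → ℂ) : Prop := ∑ i, ‖ψ i‖ ^ 2 = 1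

def IsDensity {n : Type*} [Fintype n] (ρ : Matrix n n ℂ) : Prop :=
  ρ.PosSemidef ∧ ρ.trace = 1

/-- Separable: a finite convex combination of products of density matrices. -/
def IsSeparableState (ρ : PairMat) : Prop :=
  ∃ (n : ℕ) (p : Fin n → ℝ) (σ τ : Fin n → QubitMat),
    (∀ k, 0 ≤ p k) ∧ ∑ k, p k = 1 ∧ (∀ k, IsDensity (σ k)) ∧ (∀ k, IsDensity (τ k)) ∧
      ρ = ∑ k, (p k : ℂ) • (σ k ⊗ₖ τ k)

def IsEntangled (ρ : PairMat) : Prop := ¬ IsSeparableState ρ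

/-- The support of a density matrix, i.e. its range (for a Hermitian matrix this is the orthogonal
complement of the kernel). -/
def supp (ρ : PairMat) : Submodule ℂ PairVec := LinearMap.range ρ.mulVecLin

/-- Partial trace over the second qubit. -/
def traceSecond (ρ : PairMat) : QubitMat := Matrix.of fun i j => ∑ k, ρ (i, k) (j, k)

/-- Von Neumann entropy in bits, `-∑ λ log₂ λ` over the eigenvalues with multiplicity. -/
def vnEntropy (σ : QubitMat) : ℝ :=
  (σ.charpoly.roots.map fun z => Real.negMulLog z.re).sum / Real.log 2

/-- Entropy of entanglement of the pure state `|ψ⟩⟨ψ|`. -/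
def pureEntanglement (ψ : PairVec) : ℝ := vnEntropy (traceSecond (ketBra ψ))

/-- Entanglement of formation: the infimum, over all finite decompositions of `ρ` into pure states,
of the average entropy of entanglement. -/
def entanglementOfFormation (ρ : PairMat) : ℝ :=
  sInf {e : ℝ | ∃ (n : ℕ) (p : Fin n → ℝ) (ψ : Fin n → PairVec),
    (∀ k, 0 ≤ p k) ∧ ∑ k, p k = 1 ∧ (∀ k, IsUnitVec (ψ k)) ∧
      ρ = ∑ k, (p k : ℂ) • ketBra (ψ k) ∧ e = ∑ k, p k * pureEntanglement (ψ k)}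

/-- The unnormalised output `(A ⊗ B) ρ (A ⊗ B)†`. -/
def rawFilter (A B : QubitMat) (ρ : PairMat) : PairMat := (A ⊗ₖ B) * ρ * (A ⊗ₖ B)ᴴ

/-- The output of the local operation `A ⊗ B`; used only if it occurs with nonzero probability,
`tr ((A ⊗ B) ρ (A ⊗ B)†) ≠ 0`. -/
def localFilter (A B : QubitMat) (ρ : PairMat) : PairMat :=
  (rawFilter A B ρ).trace⁻¹ • rawFilter A B ρ

/-- The optimal entanglement `M_ρ` reachable by local operations on a single copy. -/
def maxEntanglement (ρ : PairMat) : ℝ :=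
  sSup {e : ℝ | ∃ A B : QubitMat, (rawFilter A B ρ).trace ≠ 0 ∧
    e = entanglementOfFormation (localFilter A B ρ)}

/-- The Bell basis `(|00⟩ ± |11⟩)/√2`, `(|01⟩ ± |10⟩)/√2`. -/
def bellVec : Fin 4 → PairVec := fun k =>
  ((1 / Real.sqrt 2 : ℝ) : ℂ) •
    (![prodVec ![1, 0] ![1, 0] + prodVec ![0, 1] ![0, 1],
       prodVec ![1, 0] ![1, 0] - prodVec ![0, 1] ![0, 1],
       prodVec ![1, 0] ![0, 1] + prodVec ![0, 1] ![1, 0],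
       prodVec ![1, 0] ![0, 1] - prodVec ![0, 1] ![1, 0]] k)

/-- Bell-diagonal: a mixture of the Bell states, in suitable orthonormal bases of the two qubits. -/
def IsBellDiagonal (ρ : PairMat) : Prop :=
  ∃ U ∈ Matrix.unitaryGroup (Fin 2) ℂ, ∃ V ∈ Matrix.unitaryGroup (Fin 2) ℂ, ∃ p : Fin 4 → ℝ,
    (∀ k, 0 ≤ p k) ∧ ∑ k, p k = 1 ∧ ρ = rawFilter U V (∑ k, (p k : ℂ) • ketBra (bellVec k))

/-- A single local operation takes `ρ` to a Bell-diagonal state of optimal entanglement. -/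
def IncompletelyDistillable (ρ : PairMat) : Prop :=
  ∃ A B : QubitMat, (rawFilter A B ρ).trace ≠ 0 ∧
    entanglementOfFormation (localFilter A B ρ) = maxEntanglement ρ ∧
    IsBellDiagonal (localFilter A B ρ)

/-- The matrix with columns `v`, `w`; if they are independent, its inverse sends `v` to `|0⟩` and
`w` to `|1⟩`. -/
def colMat (v w : QubitVec) : QubitMat := !![v 0, w 0; v 1, w 1]

/-- The operator `a |01⟩⟨01| + b |01⟩⟨10| + b̄ |10⟩⟨01| + d |10⟩⟨10|`. -/
def antiMat (a d : ℝ) (b : ℂ) : PairMat :=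
  (a : ℂ) • Matrix.single (0, 1) (0, 1) 1 + b • Matrix.single (0, 1) (1, 0) 1
    + star b • Matrix.single (1, 0) (0, 1) 1 + (d : ℂ) • Matrix.single (1, 0) (1, 0) 1

end

/-! A pure state with coefficient matrix `ψ` has concurrence `C = 2|det ψ|`, and its entanglement is
an increasing convex function of `C` (`concEntropy`). So a decomposition into vectors of equal
concurrence bounds the entanglement of formation from above, and by Jensen a lower bound for the
average concurrence of all decompositions bounds it from below.

A filter `A ⊗ B` multiplies every determinant by `det A * det B`. An invertible filter therefore
preserves rank and product vectors, and a singular one leaves no entanglement. If the support is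
spanned by two product vectors, an invertible filter moves these to `|01⟩` and `|10⟩`, and diagonal
filters balance the weights to reach `σ = antiMat (1/2) (1/2) f`. Every filter of `ρ` is then a
filter of `σ`, and none increases the entanglement of `σ`: some rotation of the eigen-decomposition
of `σ` makes the two filtered vectors equally concurrent, with concurrence at most `2‖f‖`
(`entanglementOfFormation_localFilter_antiMat_le`), while the triangle inequality shows that `σ`
itself attains `2‖f‖`.

Conversely, on a two-dimensional support the determinant is a binary quadratic form. Either two
product vectors span the support, or the form is a nonzero multiple of a square. In the second case
all decompositions have the same positive average concurrence, so `M_ρ > 0` and an optimal filter is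
invertible. Its output is Bell-diagonal of rank two, hence supported on a product span, and this
pulls back to `ρ`. -/

/-! ### Entropy as a function of the concurrence -/

/-- Binary entropy (in bits) of the spectrum `(1 ± √(1 - C²)) / 2`. -/
noncomputable def concEntropy (C : ℝ) : ℝ :=
  Real.binEntropy ((1 - √(1 - C ^ 2)) / 2) / Real.log 2

theorem concEntropy_zero : concEntropy 0 = 0 := by simp [concEntropy]

theorem concEntropy_one : concEntropy 1 = 1 := by
  have h : (Real.log 2) ≠ 0 := by positivity
  have h2 : ((1 - √(1 - 1 ^ 2)) / 2 : ℝ) = 2⁻¹ := by norm_num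
  rw [concEntropy, h2, Real.binEntropy_two_inv, div_self h]

theorem strictMonoOn_concEntropy : StrictMonoOn concEntropy (Set.Icc 0 1) := by
  intro x hx y hy hxy
  have hlog : 0 < Real.log 2 := Real.log_pos (by norm_num)
  have hs : √(1 - y ^ 2) < √(1 - x ^ 2) :=
    Real.sqrt_lt_sqrt (by nlinarith [hy.1, hy.2]) (by nlinarith [hx.1, hx.2])
  have hx1 : √(1 - x ^ 2) ≤ 1 := Real.sqrt_le_one.mpr (by nlinarith [hx.1])
  have hy0 : 0 ≤ √(1 - y ^ 2) := Real.sqrt_nonneg _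
  refine div_lt_div_of_pos_right (Real.binEntropy_strictMonoOn ⟨?_, ?_⟩ ⟨?_, ?_⟩ ?_) hlog <;>
    norm_num <;> linarith

theorem concEntropy_nonneg {C : ℝ} (h0 : 0 ≤ C) (h1 : C ≤ 1) : 0 ≤ concEntropy C := by
  rw [← concEntropy_zero]
  exact strictMonoOn_concEntropy.monotoneOn ⟨le_rfl, zero_le_one⟩ ⟨h0, h1⟩ h0

theorem concEntropy_le_one {C : ℝ} (h0 : 0 ≤ C) (h1 : C ≤ 1) : concEntropy C ≤ 1 := by
  rw [← concEntropy_one]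
  exact strictMonoOn_concEntropy.monotoneOn ⟨h0, h1⟩ ⟨zero_le_one, le_rfl⟩ h1

/-- `2 * s` is the first term of a power series with nonnegative terms. This is the inequality
behind the convexity of `concEntropy`. -/
theorem two_mul_le_log_sub_log {s : ℝ} (h0 : 0 ≤ s) (h1 : s < 1) :
    2 * s ≤ Real.log (1 + s) - Real.log (1 - s) := by
  have h := Real.hasSum_log_sub_log_of_abs_lt_one (x := s) (by rwa [abs_of_nonneg h0])
  have h2 := sum_le_hasSum {0} (fun k _ => by positivity) h
  simpa using h2

theorem hasDerivAt_sqrt_one_sub_sq {C : ℝ} (h0 : 0 < C) (h1 : C < 1) :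
    HasDerivAt (fun C : ℝ => √(1 - C ^ 2)) (-C / √(1 - C ^ 2)) C := by
  have h : (1 - C ^ 2) ≠ 0 := by nlinarith
  have := ((hasDerivAt_pow 2 C).const_sub 1).sqrt h
  convert this using 1
  field_simp
  ring

theorem convexOn_concEntropy : ConvexOn ℝ (Set.Icc 0 1) concEntropy := by
  have hlog : 0 < Real.log 2 := Real.log_pos (by norm_num)
  have key : ConvexOn ℝ (Set.Icc (0 : ℝ) 1)
      (fun C : ℝ => Real.binEntropy ((1 - √(1 - C ^ 2)) / 2)) := by
    -- With `s = √(1 - C²)` and `L = log (1 + s) - log (1 - s)`, the derivatives are `C L / (2 s)`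
    -- and `(L / 2 - s) / s³`; the latter is nonnegative because `L ≥ 2 s`.
    refine convexOn_of_hasDerivWithinAt2_nonneg (convex_Icc 0 1)
      (f' := fun C => C / (2 * √(1 - C ^ 2)) *
        (Real.log (1 + √(1 - C ^ 2)) - Real.log (1 - √(1 - C ^ 2))))
      (f'' := fun C => ((Real.log (1 + √(1 - C ^ 2)) - Real.log (1 - √(1 - C ^ 2))) / 2
        - √(1 - C ^ 2)) / √(1 - C ^ 2) ^ 3) ?_ ?_ ?_ ?_
    · have := Real.binEntropy_continuous
      fun_prop
    all_goals
      intro C hC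
      rw [interior_Icc] at hC
      obtain ⟨h0, h1⟩ := hC
      have hpos : 0 < 1 - C ^ 2 := by nlinarith
      have hs0 : 0 < √(1 - C ^ 2) := Real.sqrt_pos.mpr hpos
      have hs1 : √(1 - C ^ 2) < 1 := by
        rw [Real.sqrt_lt' one_pos]; nlinarith
      have hsq : √(1 - C ^ 2) ^ 2 = 1 - C ^ 2 := Real.sq_sqrt hpos.le
      have hd := hasDerivAt_sqrt_one_sub_sq h0 h1
    · refine HasDerivAt.hasDerivWithinAt ?_
      have hp := (hd.const_sub 1).div_const 2
      have hb := Real.hasDerivAt_binEntropy (p := (1 - √(1 - C ^ 2)) / 2)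
        (by linarith) (by linarith)
      refine (hb.comp C hp).congr_deriv ?_
      rw [show (1 - (1 - √(1 - C ^ 2)) / 2) = (1 + √(1 - C ^ 2)) / 2 by ring,
        Real.log_div (by linarith) two_ne_zero, Real.log_div (by linarith) two_ne_zero]
      field_simp
      ring
    · refine HasDerivAt.hasDerivWithinAt ?_
      have h1' := (hasDerivAt_id C).div (hd.const_mul 2) (by positivity)
      have h2 := ((hd.const_add 1).log (by linarith)).sub ((hd.const_sub 1).log (by linarith))
      refine (h1'.mul h2).congr_deriv ?_
      simp only [Pi.sub_apply, Pi.div_apply, id]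
      generalize Real.log (1 + √(1 - C ^ 2)) - Real.log (1 - √(1 - C ^ 2)) = M
      have e1 : 1 + √(1 - C ^ 2) ≠ 0 := by linarith
      have e2 : 1 - √(1 - C ^ 2) ≠ 0 := by linarith
      generalize √(1 - C ^ 2) = s at *
      have hC2 : C ^ 2 = (1 + s) * (1 - s) := by linarith
      field_simp
      simp only [hC2]
      ring
    · have := two_mul_le_log_sub_log hs0.le hs1
      exact div_nonneg (by linarith) (by positivity)
  exact (key.smul (c := (Real.log 2)⁻¹) (by positivity)).congr
    (fun C _ => by simp [concEntropy, div_eq_inv_mul])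

/-! ### Concurrence and entanglement of pure states -/

/-- The determinant of the coefficient matrix of a two-qubit vector. -/
def pairDet (ψ : PairVec) : ℂ := ψ (0, 0) * ψ (1, 1) - ψ (0, 1) * ψ (1, 0)

theorem pairDet_smul (c : ℂ) (ψ : PairVec) : pairDet (c • ψ) = c ^ 2 * pairDet ψ := by
  simp only [pairDet, Pi.smul_apply, smul_eq_mul]; ring

theorem pairDet_prodVec (φ χ : QubitVec) : pairDet (prodVec φ χ) = 0 := by
  simp only [pairDet, prodVec]; ring

theorem sum_pair {M : Type*} [AddCommMonoid M] (g : Fin 2 × Fin 2 → M) :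
    ∑ i, g i = (g (0, 0) + g (0, 1)) + (g (1, 0) + g (1, 1)) := by
  simp [Fintype.sum_prod_type, Fin.sum_univ_two]

theorem two_mul_norm_pairDet_le (ψ : PairVec) : 2 * ‖pairDet ψ‖ ≤ ∑ i, ‖ψ i‖ ^ 2 := by
  rw [sum_pair]
  have h : ‖pairDet ψ‖ ≤ ‖ψ (0, 0)‖ * ‖ψ (1, 1)‖ + ‖ψ (0, 1)‖ * ‖ψ (1, 0)‖ := by
    rw [← norm_mul, ← norm_mul]; exact norm_sub_le _ _
  nlinarith [sq_nonneg (‖ψ (0, 0)‖ - ‖ψ (1, 1)‖), sq_nonneg (‖ψ (0, 1)‖ - ‖ψ (1, 0)‖)]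

theorem two_mul_norm_pairDet_mem_Icc {ψ : PairVec} (hψ : IsUnitVec ψ) :
    2 * ‖pairDet ψ‖ ∈ Set.Icc (0 : ℝ) 1 :=
  ⟨by positivity, (two_mul_norm_pairDet_le ψ).trans_eq hψ⟩

theorem trace_ketBra {n : Type*} [Fintype n] (ψ : n → ℂ) :
    (ketBra ψ).trace = ((∑ i, ‖ψ i‖ ^ 2 : ℝ) : ℂ) := by
  simp [ketBra, Matrix.trace, Matrix.vecMulVec_apply, Complex.mul_conj']

theorem trace_traceSecond_ketBra (ψ : PairVec) :
    (traceSecond (ketBra ψ)).trace = ((∑ i, ‖ψ i‖ ^ 2 : ℝ) : ℂ) := by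
  rw [← trace_ketBra]
  simp [traceSecond, Matrix.trace, Fin.sum_univ_two, sum_pair]

theorem det_traceSecond_ketBra (ψ : PairVec) :
    (traceSecond (ketBra ψ)).det = ((‖pairDet ψ‖ ^ 2 : ℝ) : ℂ) := by
  push_cast
  rw [← Complex.mul_conj', Matrix.det_fin_two]
  simp only [traceSecond, ketBra, pairDet, Matrix.of_apply, Matrix.vecMulVec_apply, Pi.star_apply,
    Fin.sum_univ_two, map_sub, map_mul, Complex.star_def]
  ring

/-- The reduced state has trace `1` and determinant `‖pairDet ψ‖²`, which fixes its eigenvalues as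
`(1 ± √(1 - C²)) / 2`. -/
theorem pureEntanglement_eq {ψ : PairVec} (hψ : IsUnitVec ψ) :
    pureEntanglement ψ = concEntropy (2 * ‖pairDet ψ‖) := by
  obtain ⟨h0, h1⟩ := two_mul_norm_pairDet_mem_Icc hψ
  set s : ℝ := √(1 - (2 * ‖pairDet ψ‖) ^ 2) with hs
  have hsq : s ^ 2 = 1 - (2 * ‖pairDet ψ‖) ^ 2 := Real.sq_sqrt (by nlinarith)
  have hchar : (traceSecond (ketBra ψ)).charpoly =
      (Polynomial.X - Polynomial.C (((1 - s) / 2 : ℝ) : ℂ)) *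
      (Polynomial.X - Polynomial.C (((1 - (1 - s) / 2 : ℝ)) : ℂ)) := by
    have hdet : ‖pairDet ψ‖ ^ 2 = (1 - s) / 2 * (1 - (1 - s) / 2) := by nlinarith
    rw [Matrix.charpoly_fin_two, trace_traceSecond_ketBra, det_traceSecond_ketBra, hψ, hdet,
      Complex.ofReal_mul, Polynomial.C_mul, Complex.ofReal_sub 1 ((1 - s) / 2), Polynomial.C_sub]
    simp only [Complex.ofReal_one, Polynomial.C_1]
    ring
  have hne := mul_ne_zero (Polynomial.X_sub_C_ne_zero (((1 - s) / 2 : ℝ) : ℂ))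
    (Polynomial.X_sub_C_ne_zero (((1 - (1 - s) / 2 : ℝ)) : ℂ))
  rw [pureEntanglement, vnEntropy, hchar, Polynomial.roots_mul hne, Polynomial.roots_X_sub_C,
    Polynomial.roots_X_sub_C, concEntropy, ← hs,
    Real.binEntropy_eq_negMulLog_add_negMulLog_one_sub]
  simp

theorem pureEntanglement_nonneg {ψ : PairVec} (hψ : IsUnitVec ψ) : 0 ≤ pureEntanglement ψ := by
  obtain ⟨h0, h1⟩ := two_mul_norm_pairDet_mem_Icc hψ
  rw [pureEntanglement_eq hψ]; exact concEntropy_nonneg h0 h1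

/-! ### Pure decompositions and bounds on the entanglement of formation -/

/-- A decomposition of `ρ` into pure states `ψ k` with weights `p k`. -/
structure IsPureDecomp {n : ℕ} (ρ : PairMat) (p : Fin n → ℝ) (ψ : Fin n → PairVec) : Prop where
  nonneg : ∀ k, 0 ≤ p k
  sum_eq : ∑ k, p k = 1
  unit : ∀ k, IsUnitVec (ψ k)
  eq : ρ = ∑ k, (p k : ℂ) • ketBra (ψ k)

theorem entanglementOfFormation_le_of_decomp {n : ℕ} {ρ : PairMat} {p : Fin n → ℝ}
    {ψ : Fin n → PairVec} (h : IsPureDecomp ρ p ψ) :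
    entanglementOfFormation ρ ≤ ∑ k, p k * pureEntanglement (ψ k) := by
  refine csInf_le ⟨0, ?_⟩ ⟨n, p, ψ, h.nonneg, h.sum_eq, h.unit, h.eq, rfl⟩
  rintro e ⟨n, p, ψ, hp, -, hu, -, rfl⟩
  exact Finset.sum_nonneg fun k _ => mul_nonneg (hp k) (pureEntanglement_nonneg (hu k))

theorem ketBra_smul {n : Type*} (c : ℂ) (ψ : n → ℂ) :
    ketBra (c • ψ) = ((‖c‖ ^ 2 : ℝ) : ℂ) • ketBra ψ := by
  ext i j
  simp only [ketBra, Matrix.vecMulVec_apply, Matrix.smul_apply, Pi.smul_apply, Pi.star_apply,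
    smul_eq_mul, star_mul', Complex.star_def]
  push_cast
  rw [← Complex.mul_conj']
  ring

theorem exists_isUnitVec_smul {n : Type*} [Fintype n] [Nonempty n] (w : n → ℂ) :
    ∃ ψ : n → ℂ, IsUnitVec ψ ∧ w = ((√(∑ i, ‖w i‖ ^ 2) : ℝ) : ℂ) • ψ := by
  classical
  have h0 : 0 ≤ ∑ i, ‖w i‖ ^ 2 := by positivity
  rcases h0.eq_or_lt with h | h
  · obtain ⟨i₀⟩ := ‹Nonempty n›
    refine ⟨Pi.single i₀ 1, ?_, ?_⟩
    · rw [IsUnitVec, Finset.sum_eq_single i₀] <;> simp +contextual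
    · rw [← h]
      have := (Finset.sum_eq_zero_iff_of_nonneg (fun i _ => by positivity)).mp h.symm
      ext i
      simpa using this i (Finset.mem_univ i)
  · have hs : 0 < √(∑ i, ‖w i‖ ^ 2) := Real.sqrt_pos.mpr h
    refine ⟨((√(∑ i, ‖w i‖ ^ 2) : ℝ) : ℂ)⁻¹ • w, ?_, ?_⟩
    · simp only [IsUnitVec, Pi.smul_apply, norm_smul, mul_pow]
      rw [← Finset.mul_sum, norm_inv, Complex.norm_real, Real.norm_of_nonneg hs.le, inv_pow,
        Real.sq_sqrt h.le, inv_mul_cancel₀ h.ne']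
    · rw [smul_smul, mul_inv_cancel₀ (by exact_mod_cast hs.ne'), one_smul]

/-- Normalising the vectors of `ρ = ∑ |w k⟩⟨w k|` gives a decomposition into pure states. -/
theorem exists_isPureDecomp {n : ℕ} {ρ : PairMat} (w : Fin n → PairVec) (htr : ρ.trace = 1)
    (h : ρ = ∑ k, ketBra (w k)) :
    ∃ ψ : Fin n → PairVec, IsPureDecomp ρ (fun k => ∑ i, ‖w k i‖ ^ 2) ψ ∧
      ∀ k, w k = ((√(∑ i, ‖w k i‖ ^ 2) : ℝ) : ℂ) • ψ k := by
  choose ψ hu hw using fun k => exists_isUnitVec_smul (w k)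
  refine ⟨ψ, ⟨fun k => by positivity, ?_, hu, ?_⟩, hw⟩
  · rw [h, Matrix.trace_sum] at htr
    simp only [trace_ketBra] at htr
    exact_mod_cast htr
  · rw [h]
    refine Finset.sum_congr rfl fun k _ => ?_
    conv_lhs => rw [hw k]
    rw [ketBra_smul, Complex.norm_real, Real.norm_of_nonneg (Real.sqrt_nonneg _),
      Real.sq_sqrt (by positivity)]

/-- If the vectors of `ρ = ∑ |w k⟩⟨w k|` have the same concurrence `C` (after normalisation), then
the entanglement of formation of `ρ` is at most the entropy belonging to `C`. -/
theorem entanglementOfFormation_le {n : ℕ} {ρ : PairMat} (w : Fin n → PairVec) (htr : ρ.trace = 1)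
    (h : ρ = ∑ k, ketBra (w k)) {C : ℝ}
    (hC : ∀ k, 2 * ‖pairDet (w k)‖ = C * ∑ i, ‖w k i‖ ^ 2) :
    entanglementOfFormation ρ ≤ concEntropy C := by
  obtain ⟨ψ, hd, hw⟩ := exists_isPureDecomp w htr h
  refine (entanglementOfFormation_le_of_decomp hd).trans_eq ?_
  rw [← one_mul (concEntropy C), ← hd.sum_eq, Finset.sum_mul]
  refine Finset.sum_congr rfl fun k _ => ?_
  have h0 : 0 ≤ ∑ i, ‖w k i‖ ^ 2 := by positivity
  rcases h0.eq_or_lt with h | h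
  · rw [← h]; simp
  · congr 1
    rw [pureEntanglement_eq (hd.unit k)]
    congr 1
    have := hC k
    rw [hw k, pairDet_smul, ← hw k, norm_mul, norm_pow, Complex.norm_real,
      Real.norm_of_nonneg (Real.sqrt_nonneg _), Real.sq_sqrt h.le] at this
    exact mul_right_cancel₀ h.ne' (by linarith)

-- Factor `ρ = B† B`; the vectors are the conjugated rows of `B`.
open scoped MatrixOrder in
theorem exists_sum_ketBra {ρ : PairMat} (h : ρ.PosSemidef) :
    ∃ w : Fin 4 → PairVec, ρ = ∑ k, ketBra (w k) := by
  obtain ⟨B, rfl⟩ := CStarAlgebra.nonneg_iff_eq_star_mul_self.mp h.nonneg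
  let e : Fin 4 ≃ Fin 2 × Fin 2 := (finProdFinEquiv (m := 2) (n := 2)).symm
  refine ⟨fun k i => star (B (e k) i), ?_⟩
  rw [e.sum_comp (fun k => ketBra fun i => star (B k i))]
  ext i j
  simp [Matrix.mul_apply, Matrix.sum_apply, ketBra, Matrix.vecMulVec_apply]

/-- A lower bound for the average concurrence of all pure decompositions bounds the entanglement of
formation from below. -/
theorem le_entanglementOfFormation {ρ : PairMat} (hρ : IsDensity ρ) {c : ℝ} (hc : 0 ≤ c)
    (h : ∀ (n : ℕ) (p : Fin n → ℝ) (ψ : Fin n → PairVec), IsPureDecomp ρ p ψ →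
      c ≤ ∑ k, p k * (2 * ‖pairDet (ψ k)‖)) :
    concEntropy c ≤ entanglementOfFormation ρ := by
  refine le_csInf ?_ ?_
  · obtain ⟨w, hw⟩ := exists_sum_ketBra hρ.1
    obtain ⟨ψ, hd, -⟩ := exists_isPureDecomp w hρ.2 hw
    exact ⟨_, _, _, ψ, hd.nonneg, hd.sum_eq, hd.unit, hd.eq, rfl⟩
  · rintro e ⟨n, p, ψ, hp, hs, hu, he, rfl⟩
    have hm : ∀ k ∈ Finset.univ, 2 * ‖pairDet (ψ k)‖ ∈ Set.Icc (0 : ℝ) 1 :=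
      fun k _ => two_mul_norm_pairDet_mem_Icc (hu k)
    have hle := h n p ψ ⟨hp, hs, hu, he⟩
    -- Jensen: the entropy of the average concurrence is at most the average entropy.
    have hJ := convexOn_concEntropy.map_sum_le (t := Finset.univ) (w := p)
      (fun k _ => hp k) hs hm
    have hmem := (convex_Icc (0 : ℝ) 1).sum_mem (fun k _ => hp k) hs hm
    simp only [smul_eq_mul] at hJ hmem
    calc concEntropy c ≤ _ := strictMonoOn_concEntropy.monotoneOn
          ⟨hc, hle.trans hmem.2⟩ hmem hle
      _ ≤ _ := hJ
      _ = _ := Finset.sum_congr rfl fun k _ => by rw [pureEntanglement_eq (hu k)]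

theorem entanglementOfFormation_le_one (ρ : PairMat) : entanglementOfFormation ρ ≤ 1 := by
  rcases Set.eq_empty_or_nonempty {e : ℝ | ∃ (n : ℕ) (p : Fin n → ℝ) (ψ : Fin n → PairVec),
    (∀ k, 0 ≤ p k) ∧ ∑ k, p k = 1 ∧ (∀ k, IsUnitVec (ψ k)) ∧
      ρ = ∑ k, (p k : ℂ) • ketBra (ψ k) ∧ e = ∑ k, p k * pureEntanglement (ψ k)} with h | h
  -- A matrix without pure decompositions gets the default infimum `0`.
  · rw [entanglementOfFormation, h, Real.sInf_empty]; exact zero_le_one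
  · obtain ⟨e, n, p, ψ, hp, hs, hu, he, rfl⟩ := h
    refine (entanglementOfFormation_le_of_decomp ⟨hp, hs, hu, he⟩).trans ?_
    rw [← hs]
    refine Finset.sum_le_sum fun k _ => mul_le_of_le_one_right (hp k) ?_
    obtain ⟨h0, h1⟩ := two_mul_norm_pairDet_mem_Icc (hu k)
    rw [pureEntanglement_eq (hu k)]
    exact concEntropy_le_one h0 h1

theorem le_maxEntanglement {ρ : PairMat} {A B : QubitMat} (h : (rawFilter A B ρ).trace ≠ 0) :
    entanglementOfFormation (localFilter A B ρ) ≤ maxEntanglement ρ := by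
  refine le_csSup ⟨1, ?_⟩ ⟨A, B, h, rfl⟩
  rintro e ⟨A, B, -, rfl⟩
  exact entanglementOfFormation_le_one _

/-! ### Local filters on vectors and on decompositions -/

theorem kronecker_mulVec_prodVec (A B : QubitMat) (φ χ : QubitVec) :
    (A ⊗ₖ B) *ᵥ prodVec φ χ = prodVec (A *ᵥ φ) (B *ᵥ χ) := by
  ext i
  simp only [Matrix.mulVec, dotProduct, prodVec, Matrix.kroneckerMap_apply, sum_pair,
    Fin.sum_univ_two]
  ring

/-- The coefficient matrix `ψ` becomes `A ψ Bᵀ`. -/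
theorem pairDet_kronecker_mulVec (A B : QubitMat) (ψ : PairVec) :
    pairDet ((A ⊗ₖ B) *ᵥ ψ) = A.det * B.det * pairDet ψ := by
  simp only [pairDet, Matrix.mulVec, dotProduct, Matrix.kroneckerMap_apply, sum_pair,
    Matrix.det_fin_two]
  ring

theorem rawFilter_ketBra (A B : QubitMat) (w : PairVec) :
    rawFilter A B (ketBra w) = ketBra ((A ⊗ₖ B) *ᵥ w) := by
  rw [rawFilter, ketBra, Matrix.mul_vecMulVec, Matrix.vecMulVec_mul, ketBra, Matrix.star_mulVec]

theorem rawFilter_add (A B : QubitMat) (ρ σ : PairMat) :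
    rawFilter A B (ρ + σ) = rawFilter A B ρ + rawFilter A B σ := by
  simp only [rawFilter, mul_add, add_mul]

theorem rawFilter_sum {ι : Type*} (s : Finset ι) (A B : QubitMat) (ρ : ι → PairMat) :
    rawFilter A B (∑ k ∈ s, ρ k) = ∑ k ∈ s, rawFilter A B (ρ k) := by
  simp only [rawFilter, Finset.mul_sum, Finset.sum_mul]

theorem rawFilter_smul (c : ℂ) (A B : QubitMat) (ρ : PairMat) :
    rawFilter A B (c • ρ) = c • rawFilter A B ρ := by
  simp [rawFilter]

theorem rawFilter_rawFilter (A B A' B' : QubitMat) (ρ : PairMat) :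
    rawFilter A B (rawFilter A' B' ρ) = rawFilter (A * A') (B * B') ρ := by
  simp only [rawFilter, Matrix.mul_kronecker_mul, Matrix.conjTranspose_mul, Matrix.mul_assoc]

theorem rawFilter_one (ρ : PairMat) : rawFilter 1 1 ρ = ρ := by
  simp [rawFilter]

theorem posSemidef_rawFilter (A B : QubitMat) {ρ : PairMat} (h : ρ.PosSemidef) :
    (rawFilter A B ρ).PosSemidef := h.mul_mul_conjTranspose_same _

theorem trace_localFilter {A B : QubitMat} {ρ : PairMat} (h : (rawFilter A B ρ).trace ≠ 0) :
    (localFilter A B ρ).trace = 1 := by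
  rw [localFilter, Matrix.trace_smul, smul_eq_mul, inv_mul_cancel₀ h]

/-- The local operation applied to a decomposition, with normalised vectors. -/
theorem localFilter_eq_sum_ketBra {n : ℕ} {A B : QubitMat} {ρ : PairMat} (w : Fin n → PairVec)
    (hρ : ρ = ∑ k, ketBra (w k)) {T : ℝ} (hT : (rawFilter A B ρ).trace = T) (hT0 : 0 < T) :
    localFilter A B ρ = ∑ k, ketBra (((√T)⁻¹ : ℂ) • ((A ⊗ₖ B) *ᵥ w k)) := by
  have h : ‖((√T)⁻¹ : ℂ)‖ ^ 2 = T⁻¹ := by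
    rw [norm_inv, Complex.norm_real, Real.norm_of_nonneg (Real.sqrt_nonneg _), inv_pow,
      Real.sq_sqrt hT0.le]
  rw [localFilter, hT, hρ, rawFilter_sum, Finset.smul_sum]
  refine Finset.sum_congr rfl fun k _ => ?_
  rw [ketBra_smul, rawFilter_ketBra, h, Complex.ofReal_inv]

/-! ### Rank-two Bell-diagonal states and their filtered images -/

/-- The vector `α e |01⟩ + β |10⟩`. -/
def antiVec (e : ℂ) (α β : ℝ) : PairVec :=
  (α * e : ℂ) • prodVec ![1, 0] ![0, 1] + (β : ℂ) • prodVec ![0, 1] ![1, 0]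

theorem pairDet_antiVec (e : ℂ) (α β : ℝ) : pairDet (antiVec e α β) = -(e * (α * β : ℝ)) := by
  simp only [pairDet, antiVec, prodVec, Pi.add_apply, Pi.smul_apply, Matrix.cons_val_zero,
    Matrix.cons_val_one, smul_eq_mul, Complex.ofReal_mul]
  ring

theorem antiMat_apply (a d : ℝ) (b : ℂ) (i j : Fin 2 × Fin 2) : antiMat a d b i j =
    if i = (0, 1) then (if j = (0, 1) then (a : ℂ) else if j = (1, 0) then b else 0)
    else if i = (1, 0) then (if j = (0, 1) then star b else if j = (1, 0) then (d : ℂ) else 0)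
    else 0 := by
  obtain ⟨i₁, i₂⟩ := i
  obtain ⟨j₁, j₂⟩ := j
  fin_cases i₁ <;> fin_cases i₂ <;> fin_cases j₁ <;> fin_cases j₂ <;>
    simp [antiMat]

theorem ketBra_antiVec_add {e : ℂ} (he : ‖e‖ = 1) (α β γ δ : ℝ) :
    ketBra (antiVec e α β) + ketBra (antiVec e γ δ) =
      antiMat (α ^ 2 + γ ^ 2) (β ^ 2 + δ ^ 2) (e * (α * β + γ * δ : ℝ)) := by
  have hee : e * (starRingEnd ℂ) e = 1 := by rw [Complex.mul_conj', he]; norm_num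
  ext i j
  rw [antiMat_apply]
  obtain ⟨i₁, i₂⟩ := i
  obtain ⟨j₁, j₂⟩ := j
  fin_cases i₁ <;> fin_cases i₂ <;> fin_cases j₁ <;> fin_cases j₂ <;>
    simp [ketBra, antiVec, prodVec, Matrix.vecMulVec_apply] <;>
    first | ring1 | linear_combination ((α : ℂ) ^ 2 + γ ^ 2) * hee

theorem exists_phase (f : ℂ) : ∃ e : ℂ, ‖e‖ = 1 ∧ f = e * (‖f‖ : ℝ) := by
  by_cases h : f = 0
  · exact ⟨1, by simp, by simp [h]⟩
  · have : (‖f‖ : ℂ) ≠ 0 := by simpa using h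
    refine ⟨f / ‖f‖, ?_, by field_simp⟩
    simp [h]

theorem trace_antiMat (a d : ℝ) (b : ℂ) : (antiMat a d b).trace = a + d := by
  simp [Matrix.trace, sum_pair, antiMat_apply]

/-- A filtered state cannot be more entangled than the Bell-diagonal state of rank two it comes
from. -/
theorem entanglementOfFormation_localFilter_antiMat_le {f : ℂ} (hf : 2 * ‖f‖ ≤ 1) (A B : QubitMat)
    (h : (rawFilter A B (antiMat (1 / 2) (1 / 2) f)).trace ≠ 0) :
    entanglementOfFormation (localFilter A B (antiMat (1 / 2) (1 / 2) f)) ≤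
      concEntropy (2 * ‖f‖) := by
  obtain ⟨e, he, hfe⟩ := exists_phase f
  set r := ‖f‖ with hr
  have hr0 : 0 ≤ r := norm_nonneg f
  set σ := antiMat (1 / 2) (1 / 2) f with hσ
  set u := √((1 / 2 + r) / 2) with hu
  set v := √((1 / 2 - r) / 2) with hv
  have hu2 : u ^ 2 = (1 / 2 + r) / 2 := Real.sq_sqrt (by linarith)
  have hv2 : v ^ 2 = (1 / 2 - r) / 2 := Real.sq_sqrt (by linarith)
  -- `z c s = c x + s y`, where `x = u (e|01⟩ + |10⟩)` and `y = v (e|01⟩ - |10⟩)` are the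
  -- eigenvectors scaled to have squared norms `1/2 ± r`. Rotating the pair `(x, y)` leaves the
  -- mixture unchanged.
  let z : ℝ → ℝ → PairVec := fun c s => antiVec e (c * u + s * v) (c * u - s * v)
  have hz : ∀ c s : ℝ, c ^ 2 + s ^ 2 = 1 → σ = ketBra (z c s) + ketBra (z (-s) c) := by
    intro c s hcs
    rw [ketBra_antiVec_add he, hσ, hfe]
    congr 1
    · linear_combination (-(1 / 2 : ℝ)) * hcs - (c ^ 2 + s ^ 2) * (hu2 + hv2)
    · linear_combination (-(1 / 2 : ℝ)) * hcs - (c ^ 2 + s ^ 2) * (hu2 + hv2)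
    · congr 2
      linear_combination (-r) * hcs - (c ^ 2 + s ^ 2) * (hu2 - hv2)
  let N : ℝ → ℝ → ℝ := fun c s => ∑ i, ‖((A ⊗ₖ B) *ᵥ z c s) i‖ ^ 2
  obtain ⟨T, hT⟩ : ∃ T : ℝ, (rawFilter A B σ).trace = T ∧
      ∀ c s : ℝ, c ^ 2 + s ^ 2 = 1 → N c s + N (-s) c = T := by
    have key : ∀ c s : ℝ, c ^ 2 + s ^ 2 = 1 →
        (rawFilter A B σ).trace = ((N c s + N (-s) c : ℝ) : ℂ) := by
      intro c s hcs
      rw [hz c s hcs, rawFilter_add, rawFilter_ketBra, rawFilter_ketBra, Matrix.trace_add,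
        trace_ketBra, trace_ketBra, Complex.ofReal_add]
    refine ⟨_, key 1 0 (by norm_num), fun c s hcs => ?_⟩
    have := (key c s hcs).symm.trans (key 1 0 (by norm_num))
    exact_mod_cast this
  obtain ⟨hTtr, hTN⟩ := hT
  set D := ‖A.det‖ * ‖B.det‖ with hD
  have hdet : ∀ c s, ‖pairDet ((A ⊗ₖ B) *ᵥ z c s)‖ = D * |c ^ 2 * u ^ 2 - s ^ 2 * v ^ 2| := by
    intro c s
    rw [pairDet_kronecker_mulVec, pairDet_antiVec, norm_mul, norm_mul, norm_neg, norm_mul, he,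
      Complex.norm_real, one_mul, Real.norm_eq_abs]
    congr 2
    ring
  have hD0 : 0 ≤ D := by positivity
  have hNdet : ∀ c s, 2 * (D * |c ^ 2 * u ^ 2 - s ^ 2 * v ^ 2|) ≤ N c s := fun c s => by
    rw [← hdet]; exact two_mul_norm_pairDet_le _
  -- Add the bounds `2 D u² ≤ N 1 0` and `2 D v² ≤ N (-0) 1`, using `u² + v² = 1/2`.
  have hDT : D ≤ T := by
    have h1 := hNdet 1 0
    have h2 := hNdet (-0) 1
    have h3 := hTN 1 0 (by norm_num)
    have h4 : (1 / 2 + r) / 2 ≤ |(1 : ℝ) ^ 2 * u ^ 2 - 0 ^ 2 * v ^ 2| :=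
      le_trans (by rw [hu2]; linarith) (le_abs_self _)
    have h5 : (1 / 2 - r) / 2 ≤ |(-0 : ℝ) ^ 2 * u ^ 2 - 1 ^ 2 * v ^ 2| :=
      le_trans (by rw [hv2]; linarith) (neg_le_abs _)
    have h6 := mul_le_mul_of_nonneg_left h4 hD0
    have h7 := mul_le_mul_of_nonneg_left h5 hD0
    generalize |(1 : ℝ) ^ 2 * u ^ 2 - 0 ^ 2 * v ^ 2| = m₁ at h1 h6
    generalize |(-0 : ℝ) ^ 2 * u ^ 2 - 1 ^ 2 * v ^ 2| = m₂ at h2 h7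
    linarith only [h1, h2, h3, h6, h7]
  have hT0 : 0 < T := by
    refine (hD0.trans hDT).lt_of_ne fun h0 => h ?_
    rw [hTtr, ← h0, Complex.ofReal_zero]
  -- The signed concurrences of the two unnormalised filtered vectors sum to `2 D (u² - v²) = 2 r D`
  -- for every rotation, and their squared norms sum to `T`. If both vectors have equal signed
  -- concurrence after normalisation, it must be `C`.
  set C := 2 * r * D / T with hC
  have hCT : C * T = 2 * r * D := div_mul_cancel₀ _ hT0.ne'
  have hC0 : 0 ≤ C := by positivity
  have hCr : C ≤ 2 * r := by
    rw [hC, div_le_iff₀ hT0]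
    exact mul_le_mul_of_nonneg_left hDT (by positivity)
  let g : ℝ → ℝ := fun t => 2 * D * (Real.cos t ^ 2 * u ^ 2 - Real.sin t ^ 2 * v ^ 2) -
    C * N (Real.cos t) (Real.sin t)
  have hg : Continuous g := by
    simp only [g, N, z, antiVec, Matrix.mulVec, dotProduct, sum_pair, Pi.add_apply, Pi.smul_apply]
    fun_prop
  have hsum : ∀ c s : ℝ, c ^ 2 + s ^ 2 = 1 →
      (2 * D * (c ^ 2 * u ^ 2 - s ^ 2 * v ^ 2) - C * N c s) +
      (2 * D * ((-s) ^ 2 * u ^ 2 - c ^ 2 * v ^ 2) - C * N (-s) c) = 0 := by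
    intro c s hcs
    have := hTN c s hcs
    linear_combination (-C) * this - hCT + 2 * D * (u ^ 2 - v ^ 2) * hcs + 2 * D * (hu2 - hv2)
  -- A quarter turn exchanges the two vectors up to sign, so `g 0` and `g (π/2)` are opposite. At a
  -- zero of `g` the first vector has signed concurrence `C`, and by `hsum` so has the second.
  obtain ⟨t, ht⟩ : ∃ t, g t = 0 := by
    have h2 : g 0 + g (Real.pi / 2) = 0 := by
      have hN : N 0 1 = N (-0) 1 := by rw [neg_zero]
      have := hsum 1 0 (by norm_num)
      simp only [g, Real.cos_zero, Real.sin_zero, Real.cos_pi_div_two, Real.sin_pi_div_two, hN]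
      linarith
    have hmem : (0 : ℝ) ∈ Set.uIcc (g 0) (g (Real.pi / 2)) := by
      rw [Set.mem_uIcc]
      rcases le_total 0 (g 0) with h | h
      · right; constructor <;> linarith
      · left; constructor <;> linarith
    obtain ⟨t, -, ht⟩ := intermediate_value_uIcc hg.continuousOn hmem
    exact ⟨t, ht⟩
  have hcs : Real.cos t ^ 2 + Real.sin t ^ 2 = 1 := Real.cos_sq_add_sin_sq t
  have hsum' := hsum _ _ hcs
  simp only [g] at ht
  rw [ht, zero_add] at hsum'
  set c := Real.cos t
  set s := Real.sin t
  -- Since `C * N c s ≥ 0`, the signed concurrence is nonnegative and equals its absolute value.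
  have hfin : ∀ {c s : ℝ}, 2 * D * (c ^ 2 * u ^ 2 - s ^ 2 * v ^ 2) - C * N c s = 0 →
      2 * ‖pairDet ((A ⊗ₖ B) *ᵥ z c s)‖ = C * N c s := by
    intro c s h0
    have hN : 0 ≤ C * N c s := mul_nonneg hC0 (Finset.sum_nonneg fun i _ => by positivity)
    have hq : 0 ≤ D * (c ^ 2 * u ^ 2 - s ^ 2 * v ^ 2) := by linarith
    have habs : D * |c ^ 2 * u ^ 2 - s ^ 2 * v ^ 2| = D * (c ^ 2 * u ^ 2 - s ^ 2 * v ^ 2) := by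
      rw [← abs_of_nonneg hq, abs_mul, abs_of_nonneg hD0]
    rw [hdet, habs]
    linarith
  refine (entanglementOfFormation_le
    (fun k => ((√T)⁻¹ : ℂ) • ((A ⊗ₖ B) *ᵥ (![z c s, z (-s) c] : Fin 2 → PairVec) k))
    (trace_localFilter h) (localFilter_eq_sum_ketBra _ ?_ hTtr hT0) (C := C) ?_).trans ?_
  · rw [Fin.sum_univ_two]
    exact hz c s hcs
  · have hn : ‖((√T)⁻¹ : ℂ)‖ ^ 2 = T⁻¹ := by
      rw [norm_inv, Complex.norm_real, Real.norm_of_nonneg (Real.sqrt_nonneg _), inv_pow,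
        Real.sq_sqrt hT0.le]
    intro k
    simp only [pairDet_smul, norm_mul, norm_pow, Pi.smul_apply, norm_smul, mul_pow, hn]
    rw [← Finset.mul_sum, mul_left_comm, mul_left_comm C]
    congr 1
    fin_cases k
    · exact hfin ht
    · exact hfin hsum'
  · exact strictMonoOn_concEntropy.monotoneOn ⟨hC0, hCr.trans hf⟩ ⟨by positivity, hf⟩ hCr

theorem decomp_apply {n : ℕ} {ρ : PairMat} {p : Fin n → ℝ} {ψ : Fin n → PairVec}
    (h : IsPureDecomp ρ p ψ) (i j : Fin 2 × Fin 2) :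
    ρ i j = ∑ k, (p k : ℂ) * (ψ k i * (starRingEnd ℂ) (ψ k j)) := by
  rw [h.eq, Matrix.sum_apply]
  simp [ketBra, Matrix.vecMulVec_apply]

/-- The zero `|00⟩` diagonal entry kills the `|00⟩` component of each vector of positive weight, so
its determinant has modulus `|ψ₀₁ ψ₁₀|`. Averages of `ψ₀₁ ψ̄₁₀` equal `f`; the triangle inequality
finishes. -/
theorem le_entanglementOfFormation_antiMat {f : ℂ}
    (h : IsDensity (antiMat (1 / 2) (1 / 2) f)) :
    concEntropy (2 * ‖f‖) ≤ entanglementOfFormation (antiMat (1 / 2) (1 / 2) f) := by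
  refine le_entanglementOfFormation h (by positivity) fun n p ψ hd => ?_
  have h00 : ∑ k, p k * ‖ψ k (0, 0)‖ ^ 2 = 0 := by
    have := decomp_apply hd (0, 0) (0, 0)
    simp only [antiMat_apply, Complex.mul_conj'] at this
    norm_num at this
    exact_mod_cast this.symm
  rw [Finset.sum_eq_zero_iff_of_nonneg fun k _ => mul_nonneg (hd.nonneg k) (by positivity)] at h00
  have hf : f = ∑ k, (p k : ℂ) * (ψ k (0, 1) * (starRingEnd ℂ) (ψ k (1, 0))) := by
    simpa [antiMat_apply] using decomp_apply hd (0, 1) (1, 0)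
  have hk : ∀ k, ‖(p k : ℂ) * (ψ k (0, 1) * (starRingEnd ℂ) (ψ k (1, 0)))‖ =
      p k * ‖pairDet (ψ k)‖ := by
    intro k
    rw [norm_mul, Complex.norm_real, Real.norm_of_nonneg (hd.nonneg k), norm_mul, RCLike.norm_conj]
    rcases mul_eq_zero.mp (h00 k (Finset.mem_univ k)) with h0 | h0
    · simp [h0]
    · have : ψ k (0, 0) = 0 := by simpa using h0
      simp [pairDet, this]
  have := norm_sum_le Finset.univ
    (fun k => (p k : ℂ) * (ψ k (0, 1) * (starRingEnd ℂ) (ψ k (1, 0))))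
  rw [← hf] at this
  simp only [hk] at this
  calc 2 * ‖f‖ ≤ 2 * ∑ k, p k * ‖pairDet (ψ k)‖ := by linarith
    _ = _ := by rw [Finset.mul_sum]; exact Finset.sum_congr rfl fun k _ => by ring

/-! ### Supports, product vectors and separability -/

theorem finrank_supp (ρ : PairMat) : Module.finrank ℂ (supp ρ) = ρ.rank := rfl

theorem dual_apply_mulVec {n : ℕ} (p : Fin n → ℝ) (ψ : Fin n → PairVec)
    (f : Module.Dual ℂ PairVec) (x : PairVec) :
    f ((∑ k, (p k : ℂ) • ketBra (ψ k)) *ᵥ x) = ∑ k, (p k : ℂ) * (f (ψ k) * (star (ψ k) ⬝ᵥ x)) := by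
  rw [Matrix.sum_mulVec, map_sum]
  refine Finset.sum_congr rfl fun k _ => ?_
  rw [Matrix.smul_mulVec, map_smul, smul_eq_mul, ketBra, Matrix.vecMulVec_mulVec, op_smul_eq_smul,
    map_smul, smul_eq_mul, mul_comm (f _)]

/-- The vector representing a linear functional by the inner product. -/
def rieszVec (f : Module.Dual ℂ PairVec) : PairVec := fun i => star (f (Pi.single i 1))

theorem star_dotProduct_rieszVec (f : Module.Dual ℂ PairVec) (ψ : PairVec) :
    star ψ ⬝ᵥ rieszVec f = star (f ψ) := by
  conv_rhs => rw [← Finset.univ_sum_single ψ, map_sum, star_sum]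
  refine Finset.sum_congr rfl fun i _ => ?_
  rw [show Pi.single i (ψ i) = ψ i • (Pi.single i 1 : PairVec) by
    rw [← Pi.single_smul, smul_eq_mul, mul_one], map_smul, smul_eq_mul, star_mul']
  rfl

/-- The left side depends on the mixture alone, so the average of `‖f ψ‖²` is the same for all its
decompositions. -/
theorem dual_apply_mulVec_rieszVec {n : ℕ} (p : Fin n → ℝ) (ψ : Fin n → PairVec)
    (f : Module.Dual ℂ PairVec) :
    f ((∑ k, (p k : ℂ) • ketBra (ψ k)) *ᵥ rieszVec f) =
      ((∑ k, p k * ‖f (ψ k)‖ ^ 2 : ℝ) : ℂ) := by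
  rw [dual_apply_mulVec]
  push_cast
  refine Finset.sum_congr rfl fun k _ => ?_
  rw [star_dotProduct_rieszVec, Complex.star_def, Complex.mul_conj']

/-- A functional vanishing on the support has average `‖f ψ‖²` zero, hence vanishes on every vector
of nonzero weight. -/
theorem mem_supp_of_sum {n : ℕ} {p : Fin n → ℝ} (hp : ∀ k, 0 ≤ p k) (ψ : Fin n → PairVec)
    {k : Fin n} (hk : p k ≠ 0) : ψ k ∈ supp (∑ k, (p k : ℂ) • ketBra (ψ k)) := by
  by_contra hmem
  obtain ⟨f, hfk, hf⟩ := Submodule.exists_le_ker_of_notMem hmem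
  have h0 := dual_apply_mulVec_rieszVec p ψ f
  rw [show f ((∑ k, (p k : ℂ) • ketBra (ψ k)) *ᵥ rieszVec f) = 0 from hf ⟨rieszVec f, rfl⟩] at h0
  have h1 : ∑ k, p k * ‖f (ψ k)‖ ^ 2 = 0 := by exact_mod_cast h0.symm
  rw [Finset.sum_eq_zero_iff_of_nonneg fun k _ => mul_nonneg (hp k) (by positivity)] at h1
  simpa [hk, hfk] using h1 k (Finset.mem_univ k)

/-- A singular coefficient matrix has rank at most one; a nonzero first row, if there is one, serves
as second factor. -/
theorem exists_prodVec_of_pairDet_eq_zero {ψ : PairVec} (h : pairDet ψ = 0) :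
    ∃ φ χ : QubitVec, ψ = prodVec φ χ := by
  rw [pairDet, sub_eq_zero] at h
  by_cases h0 : ψ (0, 0) = 0
  · by_cases h1 : ψ (0, 1) = 0
    · refine ⟨![0, 1], fun j => ψ (1, j), ?_⟩
      ext ⟨i, j⟩
      fin_cases i <;> fin_cases j <;> simp [prodVec, h0, h1]
    · refine ⟨![1, ψ (1, 1) / ψ (0, 1)], fun j => ψ (0, j), ?_⟩
      have h2 : ψ (1, 0) = 0 := by
        rw [h0, zero_mul, eq_comm, mul_eq_zero] at h
        exact h.resolve_left h1
      ext ⟨i, j⟩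
      fin_cases i <;> fin_cases j <;> simp [prodVec, h0, h1, h2]
  · refine ⟨![1, ψ (1, 0) / ψ (0, 0)], fun j => ψ (0, j), ?_⟩
    ext ⟨i, j⟩
    fin_cases i <;> fin_cases j <;> simp [prodVec, h0]
    field_simp
    linear_combination h

theorem ketBra_prodVec (φ χ : QubitVec) : ketBra (prodVec φ χ) = ketBra φ ⊗ₖ ketBra χ := by
  ext i j
  simp only [ketBra, prodVec, Matrix.vecMulVec_apply, Matrix.kroneckerMap_apply, Pi.star_apply,
    star_mul']
  ring

theorem isDensity_ketBra {n : Type*} [Fintype n] {ψ : n → ℂ} (h : IsUnitVec ψ) :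
    IsDensity (ketBra ψ) :=
  ⟨Matrix.posSemidef_vecMulVec_self_star ψ, by rw [trace_ketBra, h, Complex.ofReal_one]⟩

/-- A mixture of product vectors is separable. -/
theorem isSeparableState_of_sum_ketBra {n : ℕ} {ρ : PairMat} (w : Fin n → PairVec)
    (htr : ρ.trace = 1) (hρ : ρ = ∑ k, ketBra (w k)) (hw : ∀ k, pairDet (w k) = 0) :
    IsSeparableState ρ := by
  choose φ χ hφ using fun k => exists_prodVec_of_pairDet_eq_zero (hw k)
  choose φ' hφ' hφs using fun k => exists_isUnitVec_smul (φ k)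
  choose χ' hχ' hχs using fun k => exists_isUnitVec_smul (χ k)
  have hsum : ρ = ∑ k, (((∑ i, ‖φ k i‖ ^ 2) * (∑ i, ‖χ k i‖ ^ 2) : ℝ) : ℂ) •
      (ketBra (φ' k) ⊗ₖ ketBra (χ' k)) := by
    rw [hρ]
    refine Finset.sum_congr rfl fun k _ => ?_
    rw [hφ k, ketBra_prodVec]
    conv_lhs => rw [hφs k, hχs k]
    rw [ketBra_smul, ketBra_smul, Matrix.smul_kronecker, Matrix.kronecker_smul, smul_smul,
      Complex.norm_real, Complex.norm_real, Real.norm_of_nonneg (Real.sqrt_nonneg _),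
      Real.norm_of_nonneg (Real.sqrt_nonneg _), Real.sq_sqrt (by positivity),
      Real.sq_sqrt (by positivity), Complex.ofReal_mul]
  refine ⟨n, _, fun k => ketBra (φ' k), fun k => ketBra (χ' k), fun k => by positivity, ?_,
    fun k => isDensity_ketBra (hφ' k), fun k => isDensity_ketBra (hχ' k), hsum⟩
  rw [hsum, Matrix.trace_sum] at htr
  simp only [Matrix.trace_smul, Matrix.trace_kronecker, (isDensity_ketBra (hφ' _)).2,
    (isDensity_ketBra (hχ' _)).2, mul_one, smul_eq_mul] at htr
  exact_mod_cast htr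

theorem isSeparableState_of_supp {ρ : PairMat} (hρ : IsDensity ρ)
    (h : ∀ ψ ∈ supp ρ, pairDet ψ = 0) : IsSeparableState ρ := by
  obtain ⟨w, hw⟩ := exists_sum_ketBra hρ.1
  refine isSeparableState_of_sum_ketBra w hρ.2 hw fun k => h _ ?_
  have := mem_supp_of_sum (p := fun _ => 1) (fun _ => zero_le_one) w (k := k) one_ne_zero
  simpa [← hw] using this

theorem isUnit_kronecker {A B : QubitMat} (hA : A.det ≠ 0) (hB : B.det ≠ 0) :
    IsUnit (A ⊗ₖ B) := by
  rw [Matrix.isUnit_iff_isUnit_det, Matrix.det_kronecker]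
  exact (IsUnit.mk0 _ (mul_ne_zero (pow_ne_zero _ hA) (pow_ne_zero _ hB)))

theorem supp_rawFilter {A B : QubitMat} (hA : A.det ≠ 0) (hB : B.det ≠ 0) (ρ : PairMat) :
    supp (rawFilter A B ρ) = (supp ρ).map (A ⊗ₖ B).mulVecLin := by
  have hW := (isUnit_kronecker hA hB).star
  rw [Matrix.star_eq_conjTranspose] at hW
  rw [supp, rawFilter, Matrix.mulVecLin_mul, LinearMap.range_comp_of_range_eq_top,
    Matrix.mulVecLin_mul, LinearMap.range_comp, supp]
  exact LinearMap.range_eq_top.mpr (Matrix.mulVec_surjective_iff_isUnit.mpr hW)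

theorem rank_rawFilter {A B : QubitMat} (hA : A.det ≠ 0) (hB : B.det ≠ 0) (ρ : PairMat) :
    (rawFilter A B ρ).rank = ρ.rank := by
  have hW := isUnit_kronecker hA hB
  have hW' := hW.star
  rw [Matrix.star_eq_conjTranspose] at hW'
  rw [rawFilter, Matrix.rank_mul_eq_left_of_isUnit_det _ _
    ((Matrix.isUnit_iff_isUnit_det _).mp hW'), Matrix.rank_mul_eq_right_of_isUnit_det _ _
    ((Matrix.isUnit_iff_isUnit_det _).mp hW)]

theorem supp_rawFilter_of_span {A B : QubitMat} (hA : A.det ≠ 0) (hB : B.det ≠ 0) {ρ : PairMat}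
    {φ₁ φ₂ ψ₁ ψ₂ : QubitVec} (h : supp ρ = Submodule.span ℂ {prodVec φ₁ φ₂, prodVec ψ₁ ψ₂}) :
    supp (rawFilter A B ρ) = Submodule.span ℂ
      {prodVec (A *ᵥ φ₁) (B *ᵥ φ₂), prodVec (A *ᵥ ψ₁) (B *ᵥ ψ₂)} := by
  rw [supp_rawFilter hA hB, h, Submodule.map_span, Set.image_pair, Matrix.mulVecLin_apply,
    Matrix.mulVecLin_apply, kronecker_mulVec_prodVec, kronecker_mulVec_prodVec]

theorem rawFilter_inv_rawFilter {A B : QubitMat} (hA : A.det ≠ 0) (hB : B.det ≠ 0)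
    (ρ : PairMat) : rawFilter A⁻¹ B⁻¹ (rawFilter A B ρ) = ρ := by
  rw [rawFilter_rawFilter, Matrix.nonsing_inv_mul _ (IsUnit.mk0 _ hA),
    Matrix.nonsing_inv_mul _ (IsUnit.mk0 _ hB), rawFilter_one]

theorem det_inv_ne_zero {A : QubitMat} (hA : A.det ≠ 0) : A⁻¹.det ≠ 0 := by
  rw [Matrix.det_nonsing_inv, Ring.inverse_eq_inv']
  exact inv_ne_zero hA

theorem supp_smul {c : ℂ} (hc : c ≠ 0) (ρ : PairMat) : supp (c • ρ) = supp ρ := by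
  have h : (c • ρ).mulVecLin = c • ρ.mulVecLin := by
    ext1 i
    ext1
    simp
  rw [supp, h, LinearMap.range_smul _ _ hc, supp]

/-! ### The determinant form on two-dimensional spaces -/

/-- `V` is spanned by two product vectors. -/
def IsProductSpan (V : Submodule ℂ PairVec) : Prop :=
  ∃ φ₁ φ₂ ψ₁ ψ₂ : QubitVec, V = Submodule.span ℂ {prodVec φ₁ φ₂, prodVec ψ₁ ψ₂}

theorem isProductSpan_supp_of_rawFilter {A B : QubitMat} (hA : A.det ≠ 0) (hB : B.det ≠ 0)
    {ρ : PairMat} (h : IsProductSpan (supp (rawFilter A B ρ))) : IsProductSpan (supp ρ) := by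
  obtain ⟨φ₁, φ₂, ψ₁, ψ₂, h⟩ := h
  have := supp_rawFilter_of_span (det_inv_ne_zero hA) (det_inv_ne_zero hB) h
  rw [rawFilter_inv_rawFilter hA hB] at this
  exact ⟨_, _, _, _, this⟩

theorem eq_span_pair {V : Submodule ℂ PairVec} (hV : Module.finrank ℂ V = 2) {u v : PairVec}
    (h : LinearIndependent ℂ ![u, v]) (hu : u ∈ V) (hv : v ∈ V) : V = Submodule.span ℂ {u, v} := by
  refine (Submodule.eq_of_le_of_finrank_eq (Submodule.span_le.mpr ?_) ?_).symm
  · rintro x (rfl | rfl) <;> assumption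
  · have := finrank_span_eq_card h
    rw [Matrix.range_cons, Matrix.range_cons, Matrix.range_empty, Set.union_empty,
      Set.singleton_union, Fintype.card_fin] at this
    rw [this, hV]

theorem linearIndependent_combination {u v : PairVec} (h : LinearIndependent ℂ ![u, v])
    {a b c d : ℂ} (hdet : a * d - b * c ≠ 0) :
    LinearIndependent ℂ ![a • u + b • v, c • u + d • v] := by
  rw [LinearIndependent.pair_iff] at h ⊢
  intro s t hst
  obtain ⟨h1, h2⟩ := h (s * a + t * c) (s * b + t * d) (by rw [← hst]; module)
  exact ⟨(mul_eq_zero.mp (by linear_combination d * h1 - c * h2 :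
      s * (a * d - b * c) = 0)).resolve_right hdet,
    (mul_eq_zero.mp (by linear_combination a * h2 - b * h1 :
      t * (a * d - b * c) = 0)).resolve_right hdet⟩

theorem isProductSpan_of_linearIndependent {V : Submodule ℂ PairVec}
    (hV : Module.finrank ℂ V = 2) {u v : PairVec} (h : LinearIndependent ℂ ![u, v]) (hu : u ∈ V)
    (hv : v ∈ V) (hu0 : pairDet u = 0) (hv0 : pairDet v = 0) : IsProductSpan V := by
  obtain ⟨φ₁, φ₂, rfl⟩ := exists_prodVec_of_pairDet_eq_zero hu0
  obtain ⟨ψ₁, ψ₂, rfl⟩ := exists_prodVec_of_pairDet_eq_zero hv0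
  exact ⟨_, _, _, _, eq_span_pair hV h hu hv⟩

/-- The polar form of `pairDet`. -/
def pairPolar (u v : PairVec) : ℂ :=
  u (0, 0) * v (1, 1) + v (0, 0) * u (1, 1) - u (0, 1) * v (1, 0) - v (0, 1) * u (1, 0)

theorem pairDet_combination (u v : PairVec) (x y : ℂ) :
    pairDet (x • u + y • v) = x ^ 2 * pairDet u + x * y * pairPolar u v + y ^ 2 * pairDet v := by
  simp only [pairDet, pairPolar, Pi.add_apply, Pi.smul_apply, smul_eq_mul]
  ring

theorem exists_root_quadratic {a : ℂ} (ha : a ≠ 0) (b c : ℂ) : ∃ t : ℂ, t ^ 2 * a + t * b + c = 0 := by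
  obtain ⟨s, hs⟩ := IsAlgClosed.exists_eq_mul_self (discrim a b c)
  refine ⟨(-b + s) / (2 * a), ?_⟩
  rw [discrim] at hs
  field_simp
  linear_combination -hs

/-- A two-dimensional space of two-qubit vectors is spanned by product vectors, or contains exactly
one product vector up to scalars. -/
theorem isProductSpan_or_degenerate {V : Submodule ℂ PairVec} (hV : Module.finrank ℂ V = 2) :
    IsProductSpan V ∨ ∃ (u v : PairVec) (c : ℂ), c ≠ 0 ∧ LinearIndependent ℂ ![u, v] ∧
      V = Submodule.span ℂ {u, v} ∧ ∀ x y : ℂ, pairDet (x • u + y • v) = c * y ^ 2 := by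
  obtain ⟨u, v, hu, hv, hli, hu0⟩ : ∃ u v, u ∈ V ∧ v ∈ V ∧ LinearIndependent ℂ ![u, v] ∧
      pairDet u = 0 := by
    let b := Module.finBasisOfFinrankEq ℂ V hV
    have hli : LinearIndependent ℂ ![(b 0 : PairVec), (b 1 : PairVec)] := by
      have := b.linearIndependent.map' V.subtype (Submodule.ker_subtype V)
      have he : ![(b 0 : PairVec), (b 1 : PairVec)] = V.subtype ∘ b := by
        ext1 i
        fin_cases i <;> rfl
      rw [he]
      exact this
    by_cases h0 : pairDet (b 0 : PairVec) = 0
    · exact ⟨_, _, (b 0).2, (b 1).2, hli, h0⟩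
    · obtain ⟨t, ht⟩ := exists_root_quadratic h0 (pairPolar (b 0) (b 1)) (pairDet (b 1 : PairVec))
      refine ⟨t • (b 0 : PairVec) + (1 : ℂ) • (b 1 : PairVec),
        (1 : ℂ) • (b 0 : PairVec) + (0 : ℂ) • (b 1 : PairVec), ?_, ?_,
        linearIndependent_combination hli (by simp), ?_⟩
      · exact V.add_mem (V.smul_mem _ (b 0).2) (V.smul_mem _ (b 1).2)
      · exact V.add_mem (V.smul_mem _ (b 0).2) (V.smul_mem _ (b 1).2)
      · rw [pairDet_combination, ← ht]; ring
  -- With `pairDet u = 0` the form is `y (x β + y γ)`, where `β = pairPolar u v` and `γ = pairDet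
  -- v`. If `β ≠ 0`, the second root is `-γ u + β v`; if `β = 0`, the form is `γ y²`.
  by_cases hβ : pairPolar u v = 0
  · by_cases hγ : pairDet v = 0
    · exact .inl (isProductSpan_of_linearIndependent hV hli hu hv hu0 hγ)
    · refine .inr ⟨u, v, pairDet v, hγ, hli, eq_span_pair hV hli hu hv, fun x y => ?_⟩
      rw [pairDet_combination, hu0, hβ]; ring
  · left
    have h2 := linearIndependent_combination hli (a := 1) (b := 0) (c := -pairDet v)
      (d := pairPolar u v) (by simpa using hβ)
    rw [one_smul, zero_smul, add_zero] at h2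
    refine isProductSpan_of_linearIndependent hV h2 hu
      (V.add_mem (V.smul_mem _ hu) (V.smul_mem _ hv)) hu0 ?_
    rw [pairDet_combination, hu0]; ring

/-- If the support contains only one product vector up to scalars, the entanglement of formation is
positive. -/
theorem entanglementOfFormation_pos {ρ : PairMat} (hρ : IsDensity ρ) {u v : PairVec} {c : ℂ}
    (hc : c ≠ 0) (hli : LinearIndependent ℂ ![u, v]) (hV : supp ρ = Submodule.span ℂ {u, v})
    (h : ∀ x y : ℂ, pairDet (x • u + y • v) = c * y ^ 2) : 0 < entanglementOfFormation ρ := by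
  have hvu : v ∉ Submodule.span ℂ {u} := by
    rw [Submodule.mem_span_singleton]
    rintro ⟨a, ha⟩
    have := (LinearIndependent.pair_iff.mp hli a (-1) (by rw [ha]; simp)).2
    simp at this
  obtain ⟨f, hfv, hf⟩ := Submodule.exists_le_ker_of_notMem hvu
  have hfu : f u = 0 := hf (Submodule.mem_span_singleton_self u)
  -- As `f` kills `u`, it reads off the coordinate `y` up to the factor `f v`; the concurrence on
  -- the support is thus a multiple of `‖f ψ‖²`.
  have hdet : ∀ ψ ∈ supp ρ, ‖pairDet ψ‖ = ‖c‖ / ‖f v‖ ^ 2 * ‖f ψ‖ ^ 2 := by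
    intro ψ hψ
    rw [hV, Submodule.mem_span_pair] at hψ
    obtain ⟨x, y, rfl⟩ := hψ
    have : ‖f v‖ ≠ 0 := norm_ne_zero_iff.mpr hfv
    rw [h, map_add, map_smul, map_smul, hfu, smul_zero, zero_add, smul_eq_mul, norm_mul, norm_mul,
      norm_pow]
    field_simp
  have hκ : 0 < ‖c‖ / ‖f v‖ ^ 2 := by
    have := norm_pos_iff.mpr hfv
    have := norm_pos_iff.mpr hc
    positivity
  set κ := ‖c‖ / ‖f v‖ ^ 2
  set K : ℝ := (f (ρ *ᵥ rieszVec f)).re with hK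
  have hKd : ∀ {n : ℕ} {p : Fin n → ℝ} {ψ : Fin n → PairVec}, IsPureDecomp ρ p ψ →
      K = ∑ k, p k * ‖f (ψ k)‖ ^ 2 := by
    intro n p ψ hd
    rw [hK, hd.eq, dual_apply_mulVec_rieszVec, Complex.ofReal_re]
  have hCd : ∀ {n : ℕ} {p : Fin n → ℝ} {ψ : Fin n → PairVec}, IsPureDecomp ρ p ψ →
      2 * κ * K = ∑ k, p k * (2 * ‖pairDet (ψ k)‖) := by
    intro n p ψ hd
    rw [hKd hd, Finset.mul_sum]
    refine Finset.sum_congr rfl fun k _ => ?_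
    by_cases hk : p k = 0
    · simp [hk]
    · have hmem := mem_supp_of_sum hd.nonneg ψ hk
      rw [← hd.eq] at hmem
      rw [hdet _ hmem]
      ring
  obtain ⟨w, hw⟩ := exists_sum_ketBra hρ.1
  obtain ⟨ψ, hd, -⟩ := exists_isPureDecomp w hρ.2 hw
  have hK0 : 0 < K := by
    have hterm : ∀ k ∈ Finset.univ, 0 ≤ (∑ i, ‖w k i‖ ^ 2) * ‖f (ψ k)‖ ^ 2 := fun k _ => by
      positivity
    -- If `K` vanished, `f` would vanish on all vectors of nonzero weight, hence on the whole
    -- support, which contains `v`.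
    refine lt_of_le_of_ne ?_ fun h0 => hfv ?_
    · rw [hKd hd]; exact Finset.sum_nonneg hterm
    · rw [hKd hd, eq_comm, Finset.sum_eq_zero_iff_of_nonneg hterm] at h0
      have hv : v ∈ supp ρ := by rw [hV]; exact Submodule.subset_span (by simp)
      obtain ⟨x, hx⟩ := hv
      rw [← hx, Matrix.mulVecLin_apply, hd.eq, dual_apply_mulVec]
      refine Finset.sum_eq_zero fun k hk => ?_
      rcases mul_eq_zero.mp (h0 k hk) with h1 | h1
      · rw [h1]; simp
      · rw [show f (ψ k) = 0 by simpa using h1]; simp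
  have hpos : 0 < 2 * κ * K := by positivity
  have hle : 2 * κ * K ≤ 1 := by
    rw [hCd hd, ← hd.sum_eq]
    exact Finset.sum_le_sum fun k _ =>
      mul_le_of_le_one_right (hd.nonneg k) (two_mul_norm_pairDet_mem_Icc (hd.unit k)).2
  calc 0 = concEntropy 0 := concEntropy_zero.symm
    _ < concEntropy (2 * κ * K) :=
      strictMonoOn_concEntropy ⟨le_rfl, zero_le_one⟩ ⟨hpos.le, hle⟩ hpos
    _ ≤ _ := le_entanglementOfFormation hρ hpos.le fun n p ψ hd => (hCd hd).le

/-! ### Bell-diagonal states of rank two -/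

/-- The quadratic form `pairDet` is diagonal in the Bell basis, with entries `±1/2`. -/
theorem pairDet_bellVec_combination {j k : Fin 4} (hjk : j ≠ k) (x y : ℂ) :
    pairDet (x • bellVec j + y • bellVec k) =
      (![1, -1, -1, 1] j * x ^ 2 + ![1, -1, -1, 1] k * y ^ 2) / 2 := by
  have h : (((√2 : ℝ) : ℂ)⁻¹) ^ 2 = 1 / 2 := by
    rw [inv_pow, ← Complex.ofReal_pow, Real.sq_sqrt (by norm_num)]; norm_num
  fin_cases j <;> fin_cases k <;> first | exact absurd rfl hjk | skip
  all_goals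
    simp [pairDet, bellVec, prodVec]
    first
    | linear_combination (x ^ 2 + y ^ 2) * h
    | linear_combination (x ^ 2 - y ^ 2) * h
    | linear_combination (-x ^ 2 + y ^ 2) * h
    | linear_combination (-x ^ 2 - y ^ 2) * h

theorem bell_sign_sq (j : Fin 4) : (![1, -1, -1, 1] j : ℂ) ^ 2 = 1 := by
  fin_cases j <;> simp

/-- If `x b_j + y b_k = 0`, adding it to `b_j` or to `b_k` leaves the determinant unchanged.
Comparing with the diagonal form gives `x = 0` and `y = 0`. -/
theorem linearIndependent_bellVec {j k : Fin 4} (hjk : j ≠ k) :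
    LinearIndependent ℂ ![bellVec j, bellVec k] := by
  rw [LinearIndependent.pair_iff]
  intro x y h
  have h0 := pairDet_bellVec_combination hjk x y
  have h1 := pairDet_bellVec_combination hjk (x + 1) y
  have h2 := pairDet_bellVec_combination hjk x (y + 1)
  have h3 := pairDet_bellVec_combination hjk 1 0
  have h4 := pairDet_bellVec_combination hjk 0 1
  rw [show (x + 1) • bellVec j + y • bellVec k =
    x • bellVec j + y • bellVec k + ((1 : ℂ) • bellVec j + (0 : ℂ) • bellVec k) by module, h,
    zero_add, h3] at h1
  rw [show x • bellVec j + (y + 1) • bellVec k =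
    x • bellVec j + y • bellVec k + ((0 : ℂ) • bellVec j + (1 : ℂ) • bellVec k) by module, h,
    zero_add, h4] at h2
  rw [h, show pairDet 0 = 0 by simp [pairDet]] at h0
  have hj := bell_sign_sq j
  have hk := bell_sign_sq k
  generalize (![1, -1, -1, 1] j : ℂ) = ε at *
  generalize (![1, -1, -1, 1] k : ℂ) = δ at *
  constructor
  · linear_combination ε * (-h1 + h0) - x * hj
  · linear_combination δ * (-h2 + h0) - y * hk

/-- The support of a Bell-diagonal state of rank two is spanned by product vectors. -/
theorem IsBellDiagonal.isProductSpan_supp {ρ : PairMat} (h : IsBellDiagonal ρ) (hr : ρ.rank = 2) :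
    IsProductSpan (supp ρ) := by
  obtain ⟨U, hU, V, hV, p, hp, hsum, rfl⟩ := h
  have hU' : U.det ≠ 0 := (Matrix.UnitaryGroup.det_isUnit ⟨U, hU⟩).ne_zero
  have hV' : V.det ≠ 0 := (Matrix.UnitaryGroup.det_isUnit ⟨V, hV⟩).ne_zero
  rw [rank_rawFilter hU' hV'] at hr
  have hmem := fun k hk => mem_supp_of_sum hp bellVec (k := k) hk
  have hj : ∃ j, p j ≠ 0 := by
    by_contra! h0
    simp [h0] at hsum
  obtain ⟨j, hj⟩ := hj
  have hk : ∃ k, j ≠ k ∧ p k ≠ 0 := by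
    by_contra! h0
    rw [Finset.sum_eq_single j (fun k _ hk => by simp [h0 k hk.symm]) (by simp), ketBra,
      ← Matrix.smul_vecMulVec] at hr
    have := Matrix.rank_vecMulVec_le ((p j : ℂ) • bellVec j) (star (bellVec j))
    omega
  obtain ⟨k, hjk, hk⟩ := hk
  have hpart : IsProductSpan (supp (∑ k, (p k : ℂ) • ketBra (bellVec k))) := by
    -- With `s² = -ε_j ε_k`, both `±s b_j + b_k` have determinant `(ε_j s² + ε_k) / 2 = 0`.
    obtain ⟨s, hs⟩ := IsAlgClosed.exists_eq_mul_self
      (-(![1, -1, -1, 1] j * ![1, -1, -1, 1] k) : ℂ)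
    have hεj := bell_sign_sq j
    have hεk := bell_sign_sq k
    have hs4 : (s ^ 2) ^ 2 = 1 := by
      rw [pow_two s, ← hs, neg_sq, mul_pow, hεj, hεk, one_mul]
    have hs0 : s ≠ 0 := by rintro rfl; simp at hs4
    refine isProductSpan_of_linearIndependent hr
      (linearIndependent_combination (linearIndependent_bellVec hjk) (a := s) (b := 1) (c := -s)
        (d := 1) ?_) ?_ ?_ ?_ ?_
    · rw [mul_one, one_mul, sub_neg_eq_add, ← two_mul]
      exact mul_ne_zero two_ne_zero hs0
    · exact Submodule.add_mem _ (Submodule.smul_mem _ _ (hmem j hj))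
        (Submodule.smul_mem _ _ (hmem k hk))
    · exact Submodule.add_mem _ (Submodule.smul_mem _ _ (hmem j hj))
        (Submodule.smul_mem _ _ (hmem k hk))
    · rw [pairDet_bellVec_combination hjk]
      generalize (![1, -1, -1, 1] j : ℂ) = ε at *
      linear_combination (-ε / 2) * hs - (![1, -1, -1, 1] k : ℂ) / 2 * hεj
    · rw [pairDet_bellVec_combination hjk]
      generalize (![1, -1, -1, 1] j : ℂ) = ε at *
      linear_combination (-ε / 2) * hs - (![1, -1, -1, 1] k : ℂ) / 2 * hεj
  obtain ⟨φ₁, φ₂, ψ₁, ψ₂, hs⟩ := hpart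
  exact ⟨_, _, _, _, supp_rawFilter_of_span hU' hV' hs⟩

/-! ### Necessity of the product span -/

theorem exists_trace_rawFilter_eq {ρ : PairMat} (hρ : ρ.PosSemidef) {A B : QubitMat}
    (h : (rawFilter A B ρ).trace ≠ 0) : ∃ T : ℝ, (rawFilter A B ρ).trace = T ∧ 0 < T := by
  have h0 := (posSemidef_rawFilter A B hρ).trace_nonneg
  obtain ⟨hre, him⟩ := Complex.nonneg_iff.mp h0
  have hT : (rawFilter A B ρ).trace = ((rawFilter A B ρ).trace.re : ℝ) :=
    Complex.ext rfl him.symm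
  refine ⟨_, hT, hre.lt_of_ne fun h1 => h ?_⟩
  rw [hT, ← h1, Complex.ofReal_zero]

/-- A singular filter turns every vector of a decomposition into a product vector. -/
theorem entanglementOfFormation_localFilter_of_det_eq_zero {ρ : PairMat} (hρ : ρ.PosSemidef)
    {A B : QubitMat} (h : (rawFilter A B ρ).trace ≠ 0) (hdet : A.det * B.det = 0) :
    entanglementOfFormation (localFilter A B ρ) ≤ 0 := by
  obtain ⟨T, hT, hT0⟩ := exists_trace_rawFilter_eq hρ h
  obtain ⟨w, hw⟩ := exists_sum_ketBra hρ
  rw [← concEntropy_zero]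
  refine entanglementOfFormation_le _ (trace_localFilter h)
    (localFilter_eq_sum_ketBra w hw hT hT0) fun k => ?_
  rw [pairDet_smul, pairDet_kronecker_mulVec, hdet]
  simp

theorem IncompletelyDistillable.isProductSpan_supp {ρ : PairMat} (hρ : IsDensity ρ)
    (hrank : ρ.rank = 2) (h : IncompletelyDistillable ρ) : IsProductSpan (supp ρ) := by
  obtain ⟨A, B, htr, hopt, hbell⟩ := h
  rcases isProductSpan_or_degenerate hrank with h | ⟨u, v, c, hc, hli, hV, hdet⟩
  · exact h
  -- The trivial filter `1 ⊗ 1` already yields positive entanglement.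
  have hpos : 0 < maxEntanglement ρ := by
    have h1 : localFilter 1 1 ρ = ρ := by
      rw [localFilter, rawFilter_one, hρ.2, inv_one, one_smul]
    have h2 : (rawFilter 1 1 ρ).trace ≠ 0 := by rw [rawFilter_one, hρ.2]; exact one_ne_zero
    have h3 := le_maxEntanglement h2
    rw [h1] at h3
    exact (entanglementOfFormation_pos hρ hc hli hV hdet).trans_le h3
  have hAB : A.det * B.det ≠ 0 := fun h0 => by
    have := entanglementOfFormation_localFilter_of_det_eq_zero hρ.1 htr h0
    linarith
  obtain ⟨hA, hB⟩ := mul_ne_zero_iff.mp hAB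
  have hsupp : supp (localFilter A B ρ) = supp (rawFilter A B ρ) := supp_smul (inv_ne_zero htr) _
  have hr : (localFilter A B ρ).rank = 2 := by
    rw [← finrank_supp, hsupp, finrank_supp, rank_rawFilter hA hB, hrank]
  have := hbell.isProductSpan_supp hr
  rw [hsupp] at this
  exact isProductSpan_supp_of_rawFilter hA hB this

/-! ### Normal form on the span of `|01⟩` and `|10⟩` -/

/-- The kernel of a Hermitian matrix is orthogonal to its range. This gives the strict inequality
`‖b‖ < √(a d)` below. -/
theorem Matrix.PosSemidef.pos_of_mem_supp {ρ : PairMat} (hρ : ρ.PosSemidef) {x : PairVec}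
    (hx : x ∈ supp ρ) (h0 : x ≠ 0) : 0 < star x ⬝ᵥ ρ *ᵥ x := by
  refine (hρ.dotProduct_mulVec_nonneg x).lt_of_ne fun h => h0 ?_
  rw [eq_comm, hρ.dotProduct_mulVec_zero_iff] at h
  obtain ⟨y, rfl⟩ := hx
  rw [Matrix.mulVecLin_apply] at h ⊢
  rw [← dotProduct_star_self_eq_zero, Matrix.star_mulVec, hρ.1,
    ← Matrix.dotProduct_mulVec, h, dotProduct_zero]

theorem exists_eq_antiMat {ρ : PairMat} (hρ : ρ.PosSemidef) (hs : supp ρ = Submodule.span ℂ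
    {prodVec ![1, 0] ![0, 1], prodVec ![0, 1] ![1, 0]}) :
    ∃ (a d : ℝ) (b : ℂ), 0 < a ∧ 0 < d ∧ ‖b‖ < √(a * d) ∧ ρ = antiMat a d b := by
  have hcoord : ∀ x ∈ supp ρ, x (0, 0) = 0 ∧ x (1, 1) = 0 := by
    intro x hx
    rw [hs, Submodule.mem_span_pair] at hx
    obtain ⟨s, t, rfl⟩ := hx
    simp [prodVec]
  have hrow : ∀ j, ρ (0, 0) j = 0 ∧ ρ (1, 1) j = 0 := by
    intro j
    have := hcoord _ ⟨Pi.single j 1, rfl⟩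
    simpa using this
  have hherm : ∀ i j, star (ρ j i) = ρ i j := fun i j => hρ.1.apply i j
  have hreal : ∀ i, ρ i i = ((ρ i i).re : ℂ) := fun i =>
    (Complex.conj_eq_iff_re.mp (hherm i i)).symm
  obtain ⟨a, ha⟩ : ∃ a : ℝ, ρ (0, 1) (0, 1) = a := ⟨_, hreal _⟩
  obtain ⟨d, hd⟩ : ∃ d : ℝ, ρ (1, 0) (1, 0) = d := ⟨_, hreal _⟩
  obtain ⟨b, hb⟩ : ∃ b : ℂ, ρ (0, 1) (1, 0) = b := ⟨_, rfl⟩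
  have hb' : ρ (1, 0) (0, 1) = star b := by rw [← hb, hherm]
  have heq : ρ = antiMat a d b := by
    ext i j
    rw [antiMat_apply]
    obtain ⟨i₁, i₂⟩ := i
    obtain ⟨j₁, j₂⟩ := j
    have h1 := hherm (0, 1) (0, 0)
    have h2 := hherm (0, 1) (1, 1)
    have h3 := hherm (1, 0) (0, 0)
    have h4 := hherm (1, 0) (1, 1)
    simp only [(hrow _).1, (hrow _).2, star_zero] at h1 h2 h3 h4
    fin_cases i₁ <;> fin_cases i₂ <;> fin_cases j₁ <;> fin_cases j₂ <;>
      simp [hrow, ha, hd, hb, hb', ← h1, ← h2, ← h3, ← h4]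
  have hform : ∀ s t : ℂ, star (s • prodVec ![1, 0] ![0, 1] + t • prodVec ![0, 1] ![1, 0]) ⬝ᵥ
      ρ *ᵥ (s • prodVec ![1, 0] ![0, 1] + t • prodVec ![0, 1] ![1, 0]) =
      star s * (a * s + b * t) + star t * (star b * s + d * t) := by
    intro s t
    rw [heq]
    simp [Matrix.mulVec, dotProduct, sum_pair, antiMat_apply, prodVec]
  have hpos : ∀ s t : ℂ, (s ≠ 0 ∨ t ≠ 0) →
      0 < star s * (a * s + b * t) + star t * (star b * s + d * t) := by
    intro s t hst
    rw [← hform]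
    refine hρ.pos_of_mem_supp (by rw [hs, Submodule.mem_span_pair]; exact ⟨s, t, rfl⟩) fun h => ?_
    have h1 := congrFun h (0, 1)
    have h2 := congrFun h (1, 0)
    simp [prodVec] at h1 h2
    tauto
  have ha0 : 0 < a := by simpa using hpos 1 0 (by simp)
  have hd0 : 0 < d := by simpa using hpos 0 1 (by simp)
  refine ⟨a, d, b, ha0, hd0, ?_, heq⟩
  -- At `(s, t) = (-b, a)` the form takes the value `a (a d - ‖b‖²)`.
  have h := hpos (-b) a (.inr (by exact_mod_cast ha0.ne'))
  have h2 : star (-b) * (a * (-b) + b * a) + star (a : ℂ) * (star b * (-b) + d * a) =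
      ((a * (a * d - ‖b‖ ^ 2) : ℝ) : ℂ) := by
    push_cast
    rw [← Complex.mul_conj']
    simp only [Complex.star_def, Complex.conj_ofReal, map_neg]
    ring
  rw [h2] at h
  have h3 : 0 < a * (a * d - ‖b‖ ^ 2) := by exact_mod_cast h
  have h4 : 0 < a * d - ‖b‖ ^ 2 := (mul_pos_iff_of_pos_left ha0).mp h3
  exact Real.lt_sqrt_of_sq_lt (by linarith)

theorem rawFilter_diagonal_antiMat (x y : QubitVec) (a d : ℝ) (b : ℂ) :
    rawFilter (Matrix.diagonal x) (Matrix.diagonal y) (antiMat a d b) =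
      antiMat (‖x 0 * y 1‖ ^ 2 * a) (‖x 1 * y 0‖ ^ 2 * d) (x 0 * y 1 * b * star (x 1 * y 0)) := by
  rw [rawFilter, Matrix.diagonal_kronecker_diagonal, Matrix.diagonal_conjTranspose]
  ext i j
  rw [Matrix.mul_diagonal, Matrix.diagonal_mul, antiMat_apply, antiMat_apply]
  push_cast
  rw [← Complex.mul_conj', ← Complex.mul_conj']
  obtain ⟨i₁, i₂⟩ := i
  obtain ⟨j₁, j₂⟩ := j
  fin_cases i₁ <;> fin_cases i₂ <;> fin_cases j₁ <;> fin_cases j₂ <;> simp <;> ring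

theorem sum_bellVec_eq_antiMat (r : ℝ) :
    ∑ k, ((![0, 0, 1 / 2 + r, 1 / 2 - r] k : ℝ) : ℂ) • ketBra (bellVec k) =
      antiMat (1 / 2) (1 / 2) r := by
  have h : (((√2 : ℝ) : ℂ)⁻¹) ^ 2 = 1 / 2 := by
    rw [inv_pow, ← Complex.ofReal_pow, Real.sq_sqrt (by norm_num)]; norm_num
  ext i j
  rw [antiMat_apply, Matrix.sum_apply, Fin.sum_univ_four]
  obtain ⟨i₁, i₂⟩ := i
  obtain ⟨j₁, j₂⟩ := j
  fin_cases i₁ <;> fin_cases i₂ <;> fin_cases j₁ <;> fin_cases j₂ <;>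
    simp [ketBra, bellVec, prodVec, Matrix.vecMulVec_apply] <;>
    first | linear_combination h | linear_combination 2 * (r : ℂ) * h

/-- A diagonal unitary on the first qubit absorbs the phase of `f`; the eigenvalues `1/2 ± ‖f‖` are
the Bell weights. -/
theorem isBellDiagonal_antiMat {f : ℂ} (hf : 2 * ‖f‖ ≤ 1) :
    IsBellDiagonal (antiMat (1 / 2) (1 / 2) f) := by
  obtain ⟨e, he, hfe⟩ := exists_phase f
  refine ⟨Matrix.diagonal ![e, 1], ?_, 1, one_mem _, ![0, 0, 1 / 2 + ‖f‖, 1 / 2 - ‖f‖], ?_, ?_, ?_⟩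
  · rw [Matrix.mem_unitaryGroup_iff, Matrix.star_eq_conjTranspose, Matrix.diagonal_conjTranspose,
      Matrix.diagonal_mul_diagonal, ← Matrix.diagonal_one]
    congr 1
    ext i
    fin_cases i <;> simp [Complex.mul_conj', he]
  · have := norm_nonneg f
    intro k
    fin_cases k <;> simp <;> linarith
  · rw [Fin.sum_univ_four]
    simp
    ring
  · rw [sum_bellVec_eq_antiMat, ← Matrix.diagonal_one, rawFilter_diagonal_antiMat]
    simp [he, ← hfe]

theorem isDensity_antiMat {f : ℂ} (hf : 2 * ‖f‖ ≤ 1) : IsDensity (antiMat (1 / 2) (1 / 2) f) := by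
  obtain ⟨U, hU, V, hV, p, hp, hsum, h⟩ := isBellDiagonal_antiMat hf
  refine ⟨?_, by rw [trace_antiMat]; norm_num⟩
  rw [h]
  refine posSemidef_rawFilter U V (Matrix.posSemidef_sum _ fun k _ => ?_)
  exact (Matrix.posSemidef_vecMulVec_self_star (bellVec k)).smul (by exact_mod_cast hp k)

/-! ### Optimality and the theorem -/

/-- A state that an invertible local operation takes to a Bell-diagonal state of rank two has the
entanglement of that state as its optimal entanglement. -/
theorem maxEntanglement_eq {ρ : PairMat} {A B : QubitMat} (hA : A.det ≠ 0) (hB : B.det ≠ 0) {f : ℂ}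
    (hf : 2 * ‖f‖ ≤ 1) (h : rawFilter A B ρ = antiMat (1 / 2) (1 / 2) f) :
    entanglementOfFormation (antiMat (1 / 2) (1 / 2) f) = maxEntanglement ρ ∧
      maxEntanglement ρ = concEntropy (2 * ‖f‖) := by
  have htr : (antiMat (1 / 2) (1 / 2) f).trace = 1 := by rw [trace_antiMat]; norm_num
  have h1 := le_maxEntanglement (ρ := ρ) (A := A) (B := B) (by rw [h, htr]; exact one_ne_zero)
  rw [localFilter, h, htr, inv_one, one_smul] at h1
  have h2 := le_entanglementOfFormation_antiMat (isDensity_antiMat hf)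
  have h3 : maxEntanglement ρ ≤ concEntropy (2 * ‖f‖) := by
    refine csSup_le ⟨_, A, B, by rw [h, htr]; exact one_ne_zero, rfl⟩ ?_
    rintro e ⟨A', B', htr', rfl⟩
    -- Undoing the invertible filter makes every filter of `ρ` a filter of the Bell-diagonal state.
    have hρ : ρ = rawFilter A⁻¹ B⁻¹ (antiMat (1 / 2) (1 / 2) f) := by
      rw [← h, rawFilter_inv_rawFilter hA hB]
    have hraw : rawFilter A' B' ρ =
        rawFilter (A' * A⁻¹) (B' * B⁻¹) (antiMat (1 / 2) (1 / 2) f) := by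
      rw [hρ, rawFilter_rawFilter]
    have hloc : localFilter A' B' ρ =
        localFilter (A' * A⁻¹) (B' * B⁻¹) (antiMat (1 / 2) (1 / 2) f) := by
      rw [localFilter, localFilter, hraw]
    rw [hloc]
    exact entanglementOfFormation_localFilter_antiMat_le hf _ _ (by rwa [← hraw])
  exact ⟨le_antisymm h1 (h3.trans h2), le_antisymm h3 (h2.trans h1)⟩

theorem pairDet_combination_prodVec (φ₁ φ₂ ψ₁ ψ₂ : QubitVec) (x y : ℂ) :
    pairDet (x • prodVec φ₁ φ₂ + y • prodVec ψ₁ ψ₂) =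
      -(x * y * ((colMat φ₁ ψ₁).det * (colMat ψ₂ φ₂).det)) := by
  rw [pairDet_combination, pairDet_prodVec, pairDet_prodVec]
  simp only [pairPolar, prodVec, colMat, Matrix.det_fin_two_of]
  ring

theorem inv_colMat_mulVec_left {v w : QubitVec} (h : (colMat v w).det ≠ 0) :
    (colMat v w)⁻¹ *ᵥ v = ![1, 0] := by
  have : v = colMat v w *ᵥ ![1, 0] := by
    ext i; fin_cases i <;> simp [colMat, Matrix.mulVec, dotProduct]
  conv_lhs => rw [this]
  rw [Matrix.mulVec_mulVec, ← this, Matrix.nonsing_inv_mul _ (IsUnit.mk0 _ h), Matrix.one_mulVec]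

theorem inv_colMat_mulVec_right {v w : QubitVec} (h : (colMat v w).det ≠ 0) :
    (colMat v w)⁻¹ *ᵥ w = ![0, 1] := by
  have : w = colMat v w *ᵥ ![0, 1] := by
    ext i; fin_cases i <;> simp [colMat, Matrix.mulVec, dotProduct]
  conv_lhs => rw [this]
  rw [Matrix.mulVec_mulVec, ← this, Matrix.nonsing_inv_mul _ (IsUnit.mk0 _ h), Matrix.one_mulVec]

/-- Without off-diagonal terms the filtered state is a mixture of multiples of `|01⟩` and `|10⟩`;
the inverse filter keeps these product vectors. -/
theorem isSeparableState_of_rawFilter_eq_antiMat_zero {ρ : PairMat} (hρ : IsDensity ρ)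
    {A B : QubitMat} (hA : A.det ≠ 0) (hB : B.det ≠ 0) {a d : ℝ} (ha : 0 < a) (hd : 0 < d)
    (h : rawFilter A B ρ = antiMat a d 0) : IsSeparableState ρ := by
  have h0 : ketBra (antiVec 1 (√a) 0) + ketBra (antiVec 1 0 (√d)) = antiMat a d 0 := by
    rw [ketBra_antiVec_add (by simp)]
    simp [Real.sq_sqrt ha.le, Real.sq_sqrt hd.le]
  refine isSeparableState_of_sum_ketBra (fun k => (A⁻¹ ⊗ₖ B⁻¹) *ᵥ
    (![antiVec 1 (√a) 0, antiVec 1 0 (√d)] : Fin 2 → PairVec) k) hρ.2 ?_ fun k => ?_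
  · rw [Fin.sum_univ_two, ← rawFilter_ketBra, ← rawFilter_ketBra, ← rawFilter_add]
    simp only [Matrix.cons_val_zero, Matrix.cons_val_one]
    rw [h0, ← h, rawFilter_inv_rawFilter hA hB]
  · rw [pairDet_kronecker_mulVec]
    fin_cases k <;> simp [pairDet_antiVec]

theorem normal_form_of_supp {ρ : PairMat} (hρ : IsDensity ρ) (hent : IsEntangled ρ)
    (hrank : ρ.rank = 2) {φ₁ φ₂ ψ₁ ψ₂ : QubitVec}
    (hs : supp ρ = Submodule.span ℂ {prodVec φ₁ φ₂, prodVec ψ₁ ψ₂}) :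
    (colMat φ₁ ψ₁).det ≠ 0 ∧ (colMat ψ₂ φ₂).det ≠ 0 ∧
      ∃ (a d : ℝ) (b : ℂ), 0 < a ∧ 0 < d ∧ 0 < ‖b‖ ∧ ‖b‖ < Real.sqrt (a * d) ∧
        rawFilter (colMat φ₁ ψ₁)⁻¹ (colMat ψ₂ φ₂)⁻¹ ρ = antiMat a d b ∧
        ∃ A B : QubitMat,
          A = ((1 / Real.sqrt 2 : ℝ) : ℂ) •
            (Matrix.diagonal ![1, ((1 / Real.sqrt d : ℝ) : ℂ)] * (colMat φ₁ ψ₁)⁻¹) ∧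
          B = Matrix.diagonal ![1, ((1 / Real.sqrt a : ℝ) : ℂ)] * (colMat ψ₂ φ₂)⁻¹ ∧
          (rawFilter A B ρ).trace = 1 ∧
          localFilter A B ρ = antiMat (1 / 2) (1 / 2) (b / ((2 * Real.sqrt (a * d) : ℝ) : ℂ)) ∧
          (localFilter A B ρ).rank = 2 ∧
          IsBellDiagonal (localFilter A B ρ) ∧
          entanglementOfFormation (localFilter A B ρ) = maxEntanglement ρ ∧
          maxEntanglement ρ < 1 := by
  -- Otherwise the determinant vanishes on the whole support and `ρ` is separable.
  have hdet : (colMat φ₁ ψ₁).det * (colMat ψ₂ φ₂).det ≠ 0 := fun h0 => by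
    refine hent (isSeparableState_of_supp hρ fun χ hχ => ?_)
    rw [hs, Submodule.mem_span_pair] at hχ
    obtain ⟨x, y, rfl⟩ := hχ
    rw [pairDet_combination_prodVec, h0, mul_zero, neg_zero]
  obtain ⟨hS, hT⟩ := mul_ne_zero_iff.mp hdet
  have hS' := det_inv_ne_zero hS
  have hT' := det_inv_ne_zero hT
  -- The swapped columns of the second matrix send `φ₁ ⊗ φ₂` to `|01⟩` and `ψ₁ ⊗ ψ₂` to `|10⟩`.
  have hs' := supp_rawFilter_of_span hS' hT' hs
  rw [inv_colMat_mulVec_left hS, inv_colMat_mulVec_right hS, inv_colMat_mulVec_left hT,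
    inv_colMat_mulVec_right hT] at hs'
  obtain ⟨a, d, b, ha, hd, hbad, hraw⟩ := exists_eq_antiMat (posSemidef_rawFilter _ _ hρ.1) hs'
  have hb : b ≠ 0 := by
    rintro rfl
    exact hent (isSeparableState_of_rawFilter_eq_antiMat_zero hρ hS' hT' ha hd hraw)
  refine ⟨hS, hT, a, d, b, ha, hd, norm_pos_iff.mpr hb, hbad, hraw, _, _, rfl, rfl, ?_⟩
  set A : QubitMat := ((1 / Real.sqrt 2 : ℝ) : ℂ) •
    (Matrix.diagonal ![1, ((1 / Real.sqrt d : ℝ) : ℂ)] * (colMat φ₁ ψ₁)⁻¹) with hA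
  set B : QubitMat := Matrix.diagonal ![1, ((1 / Real.sqrt a : ℝ) : ℂ)] * (colMat ψ₂ φ₂)⁻¹ with hB
  set f : ℂ := b / ((2 * Real.sqrt (a * d) : ℝ) : ℂ) with hf
  have hsa : 0 < √a := Real.sqrt_pos.mpr ha
  have hsd : 0 < √d := Real.sqrt_pos.mpr hd
  have hs2 : 0 < √(2 : ℝ) := Real.sqrt_pos.mpr two_pos
  have hsad : 0 < √(a * d) := Real.sqrt_pos.mpr (mul_pos ha hd)
  have hAdet : A.det ≠ 0 := by
    rw [hA, Matrix.det_smul, Matrix.det_mul, Matrix.det_diagonal, Fin.prod_univ_two]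
    refine mul_ne_zero (pow_ne_zero _ ?_) (mul_ne_zero (mul_ne_zero one_ne_zero ?_) hS')
    · exact_mod_cast (one_div_pos.mpr hs2).ne'
    · exact Complex.ofReal_ne_zero.mpr (one_div_pos.mpr hsd).ne'
  have hBdet : B.det ≠ 0 := by
    rw [hB, Matrix.det_mul, Matrix.det_diagonal, Fin.prod_univ_two]
    refine mul_ne_zero (mul_ne_zero one_ne_zero ?_) hT'
    exact Complex.ofReal_ne_zero.mpr (one_div_pos.mpr hsa).ne'
  have hout : rawFilter A B ρ = antiMat (1 / 2) (1 / 2) f := by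
    rw [hA, hB, ← Matrix.smul_mul, ← rawFilter_rawFilter, hraw, ← Matrix.diagonal_smul,
      rawFilter_diagonal_antiMat]
    congr 1
    · simp [abs_of_pos hsa, abs_of_pos hs2]
      field_simp
      rw [Real.sq_sqrt ha.le, Real.sq_sqrt two_pos.le, mul_comm]
    · simp [abs_of_pos hsd, abs_of_pos hs2]
      field_simp
      rw [Real.sq_sqrt hd.le, Real.sq_sqrt two_pos.le, mul_comm]
    · have h2 : ((√2 : ℝ) : ℂ) ^ 2 = 2 := by
        rw [← Complex.ofReal_pow, Real.sq_sqrt two_pos.le]; norm_num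
      have e1 : ((√a : ℝ) : ℂ) ≠ 0 := Complex.ofReal_ne_zero.mpr hsa.ne'
      have e2 : ((√d : ℝ) : ℂ) ≠ 0 := Complex.ofReal_ne_zero.mpr hsd.ne'
      have e3 : ((√2 : ℝ) : ℂ) ≠ 0 := Complex.ofReal_ne_zero.mpr hs2.ne'
      rw [hf, Real.sqrt_mul ha.le]
      simp
      field_simp
      rw [h2]
  have htr : (rawFilter A B ρ).trace = 1 := by rw [hout, trace_antiMat]; norm_num
  have hloc : localFilter A B ρ = rawFilter A B ρ := by
    rw [localFilter, htr, inv_one, one_smul]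
  -- Here `2‖f‖ = ‖b‖ / √(a d)`, so the strict bound on `b` is what makes the optimal entanglement
  -- less than `1`.
  have hf1 : 2 * ‖f‖ < 1 := by
    rw [hf, norm_div, Complex.norm_real, Real.norm_of_nonneg (by positivity)]
    rw [← mul_div_assoc, div_lt_one (by positivity)]
    linarith
  obtain ⟨hM, hM'⟩ := maxEntanglement_eq hAdet hBdet hf1.le hout
  refine ⟨htr, by rw [hloc, hout], ?_, ?_, ?_, ?_⟩
  · rw [hloc, rank_rawFilter hAdet hBdet, hrank]
  · rw [hloc, hout]; exact isBellDiagonal_antiMat hf1.le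
  · rw [hloc, hout, hM]
  · rw [hM', ← concEntropy_one]
    exact strictMonoOn_concEntropy ⟨by positivity, hf1.le⟩ ⟨zero_le_one, le_rfl⟩ hf1

theorem mainTheorem4 (ρ : PairMat) (hρ : IsDensity ρ) (hent : IsEntangled ρ) (hrank : ρ.rank = 2) :
    (IncompletelyDistillable ρ ↔
      ∃ φ₁ φ₂ ψ₁ ψ₂ : QubitVec, supp ρ = Submodule.span ℂ {prodVec φ₁ φ₂, prodVec ψ₁ ψ₂}) ∧
    (∀ φ₁ φ₂ ψ₁ ψ₂ : QubitVec, supp ρ = Submodule.span ℂ {prodVec φ₁ φ₂, prodVec ψ₁ ψ₂} →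
      (colMat φ₁ ψ₁).det ≠ 0 ∧ (colMat ψ₂ φ₂).det ≠ 0 ∧
      ∃ (a d : ℝ) (b : ℂ), 0 < a ∧ 0 < d ∧ 0 < ‖b‖ ∧ ‖b‖ < Real.sqrt (a * d) ∧
        rawFilter (colMat φ₁ ψ₁)⁻¹ (colMat ψ₂ φ₂)⁻¹ ρ = antiMat a d b ∧
        ∃ A B : QubitMat,
          A = ((1 / Real.sqrt 2 : ℝ) : ℂ) •
            (Matrix.diagonal ![1, ((1 / Real.sqrt d : ℝ) : ℂ)] * (colMat φ₁ ψ₁)⁻¹) ∧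
          B = Matrix.diagonal ![1, ((1 / Real.sqrt a : ℝ) : ℂ)] * (colMat ψ₂ φ₂)⁻¹ ∧
          (rawFilter A B ρ).trace = 1 ∧
          localFilter A B ρ = antiMat (1 / 2) (1 / 2) (b / ((2 * Real.sqrt (a * d) : ℝ) : ℂ)) ∧
          (localFilter A B ρ).rank = 2 ∧
          IsBellDiagonal (localFilter A B ρ) ∧
          entanglementOfFormation (localFilter A B ρ) = maxEntanglement ρ ∧
          maxEntanglement ρ < 1) := by
  refine ⟨⟨fun h => h.isProductSpan_supp hρ hrank, ?_⟩, fun φ₁ φ₂ ψ₁ ψ₂ hs =>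
    normal_form_of_supp hρ hent hrank hs⟩
  rintro ⟨φ₁, φ₂, ψ₁, ψ₂, hs⟩
  obtain ⟨-, -, a, d, b, -, -, -, -, -, A, B, -, -, htr, -, -, hbell, hopt, -⟩ :=
    normal_form_of_supp hρ hent hrank hs
  exact ⟨A, B, by rw [htr]; exact one_ne_zero, hopt, hbell⟩
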